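/- **Lemma q (Expected number of nearest-neighbor pairs).** Let $m\ge 1$, let $\mathcal M\subset\mathbb R^d$ be an $m$-dimensional embedded $C^\infty$ submanifold, and let $\mu$ be a probability measure on $\mathcal M$ such that for every chart $(U,\psi)$ of the maximal smooth atlas of $\mathcal M$, $\psi:U\to V\subset\mathbb R^m$, the push-forward $\psi_*(\mu|_U)$ is absolutely continuous with respect to Lebesgue measure. Let $X_1,X_2,\dots$ be independent $\mathcal M$-valued random variables with law $\mu$. Let $\mathcal G_n$ be the directed nearest-neighbor graph on $\{1,\dots,n\}$: $i\to j$ is an edge if $j\ne i$ and $\|X_i-X_j\|\le\|X_i-X_k\|$ for all $k\ne i$, where $\|\cdot\|$ is the Euclidean norm of $\mathbb R^d$. Then, as $n\to\infty$, $$\mathbb E\Big(\frac1n\,\#\big\{(i,j)\ \text{distinct}:\ i\to j \text{ and } j\to i \text{ are edges of } \mathcal G_n\big\}\Big)\longrightarrow \mathfrak q_m:=\frac{V_m}{U_m},$$ where the pairs $(i,j)$ are ordered, $V_m$ is the volume of the unit ball in $\mathbb R^m$, and $U_m$ is the volume of the union of two unit balls in $\mathbb R^m$ whose centers are at distance $1$.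 The same limit holds if, in the definition of $\mathcal G_n$, $i\to j$ is an edge only when $X_j$ is the unique nearest neighbor of $X_i$, that is, $j\ne i$ and $\|X_i-X_j\|<\|X_i-X_k\|$ for all $k\ne i,j$. -/

import Mathlib

open MeasureTheory ProbabilityTheory Filter Topology
open scoped Manifold ContDiff

/-- Absolute continuity in charts of a measure `μ` on an `m`-dimensional smooth manifold `M`:
for every chart `(U, ψ)` of the maximal smooth atlas of `M`, the push-forward under `ψ` of the
restriction of `μ` to `U` is absolutely continuous with respect to Lebesgue measure. -/
def AbsolutelyContinuousInCharts (m : ℕ) {M : Type*} [TopologicalSpace M]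
    [ChartedSpace (EuclideanSpace ℝ (Fin m)) M] [MeasurableSpace M] (μ : Measure M) : Prop :=
  ∀ ψ ∈ IsManifold.maximalAtlas (𝓡 m) ∞ M,
    (μ.restrict ψ.source).map ψ ≪ (volume : Measure (EuclideanSpace ℝ (Fin m)))

/-- The directed nearest-neighbour graph of the points `x 0, …, x (n - 1)`: there is an edge
`i → j` if `x j` is a nearest neighbour of `x i` among the points `x k`, `k ≠ i`. -/
def nearestNeighborGraph {E : Type*} [PseudoMetricSpace E] {n : ℕ} (x : Fin n → E) :
    Digraph (Fin n) where
  Adj i j := j ≠ i ∧ ∀ k, k ≠ i → dist (x i) (x j) ≤ dist (x i) (x k)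

/-- The directed graph in which `i → j` is an edge only if `x j` is the unique nearest neighbour
of `x i` (no ties). It agrees with `nearestNeighborGraph` when there are no ties, and every
rule for breaking ties gives a graph that lies between the two. -/
def uniqueNearestNeighborGraph {E : Type*} [PseudoMetricSpace E] {n : ℕ} (x : Fin n → E) :
    Digraph (Fin n) where
  Adj i j := j ≠ i ∧ ∀ k, k ≠ i → k ≠ j → dist (x i) (x j) < dist (x i) (x k)

/-- The number of ordered pairs `(i, j)` of distinct vertices with `i → j` and `j → i`. -/
noncomputable def mutualPairs {V : Type*} (G : Digraph V) : ℕ :=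
  Set.ncard {p : V × V | p.1 ≠ p.2 ∧ G.Adj p.1 p.2 ∧ G.Adj p.2 p.1}

/-- The volume `V_m` of the unit ball of `ℝ^m`. -/
noncomputable def unitBallVolume (m : ℕ) : ℝ :=
  volume.real (Metric.ball (0 : EuclideanSpace ℝ (Fin m)) 1)

/-- The volume `U_m` of the union of two unit balls of `ℝ^m` (`m ≥ 1`) whose centres, here the
origin and the first standard basis vector, are at distance one. -/
noncomputable def twoBallsVolume (m : ℕ) : ℝ :=
  volume.real (Metric.ball (0 : EuclideanSpace ℝ (Fin m)) 1 ∪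
    Metric.ball (WithLp.toLp 2 fun i : Fin m => if i.val = 0 then (1 : ℝ) else 0) 1)

/-- The constant `q_m = V_m / U_m`. -/
noncomputable def nearestNeighborPairConst (m : ℕ) : ℝ :=
  unitBallVolume m / twoBallsVolume m

/-!
For distinct `i`, `j` at distance `r`, both `i → j` and `j → i` are edges exactly when no other
sample point lies in the union `S (X i) (X j)` of the two balls of radius `r` around `X i` and `X j`
(open balls for `nearestNeighborGraph`, closed balls for `uniqueNearestNeighborGraph`). With
`H x y = μ (S x y)`, independence gives
`E (number of mutual pairs) / n = (n - 1) ∫ x, ∫ y, (1 - H x y) ^ (n - 2)`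
(`integral_mutualPairs_eq`). The theorem follows by dominated convergence in `x` from two facts
about the distribution function `D_x s = μ {y | H x y ≤ s}`.

* For almost every `x`, `D_x s / s → V_m / U_m` as `s → 0`. Near a Lebesgue point of the density in
  a chart, the embedding is nearly an isometry in suitable linear coordinates
  (`Manifold.IsImmersionAt.exists_near_isometry`), so that for some `b > 0` a small ball around `x`
  of radius `r` has measure about `b V_m r ^ m`, and `H x y` is about `b U_m r ^ m` for
  `r = dist x y` (`AbsolutelyContinuousInCharts.ae_hasTwoBallAsymptotics`). Thus `{H x ≤ s}` is
  nearly a ball around `x` of measure `(V_m / U_m) s`. That the volume of the union of two balls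
  increases with the distance of the centres (`measureReal_ball_union_ball_mono`) absorbs the
  distortion of `dist x y` by the chart. By the layer-cake formula and a Beta integral,
  `(n - 1) ∫ y, (1 - H x y) ^ (n - 2)` then tends to `V_m / U_m` (`tendsto_integral_one_sub_pow`).
* `D_x s ≤ K s` for all `x` and `s ≥ 0`, where `K` depends only on `d`
  (`exists_forall_measureReal_sublevel_le`). This bounds the inner integrals by `K`. Ties of
  distances may have positive probability, but the bound does not depend on their absence.
-/

/-! ### Powers of `1 - H` and the distribution function of `H` -/

/-- Layer-cake formula: the integral of a power of `1 - H` in terms of the distribution function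
of `H`. -/
lemma integral_one_sub_pow_eq_integral_cdf {Y : Type*} [MeasurableSpace Y] (μ : Measure Y)
    [IsProbabilityMeasure μ] {H : Y → ℝ} (hH : Measurable H) (h0 : ∀ y, 0 ≤ H y)
    (h1 : ∀ y, H y ≤ 1) (k : ℕ) :
    ∫ y, (1 - H y) ^ (k + 1) ∂μ =
      ∫ s in (0 : ℝ)..1, (k + 1) * (1 - s) ^ k * μ.real {y | H y ≤ s} := by
  have hprim : ∀ h : ℝ, ∫ s in h..1, ((k : ℝ) + 1) * (1 - s) ^ k = (1 - h) ^ (k + 1) := by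
    intro h
    rw [intervalIntegral.integral_const_mul,
      intervalIntegral.integral_comp_sub_left (fun s : ℝ => s ^ k) 1, integral_pow]
    have : (k : ℝ) + 1 ≠ 0 := by positivity
    field_simp
    simp
  have hpt : ∀ y, (1 - H y) ^ (k + 1) = ∫ s in Set.Ioc (0 : ℝ) 1,
      (Set.Ici (H y)).indicator (fun s => ((k : ℝ) + 1) * (1 - s) ^ k) s := by
    intro y
    rw [← hprim, intervalIntegral.integral_of_le (h1 y), setIntegral_indicator measurableSet_Ici]
    refine setIntegral_congr_set ?_
    have hsub : Set.Ioc (H y) 1 ⊆ Set.Ioc 0 1 ∩ Set.Ici (H y) := fun s hs =>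
      ⟨⟨(h0 y).trans_lt hs.1, hs.2⟩, hs.1.le⟩
    refine (hsub.eventuallyLE).antisymm ?_
    have : ∀ᵐ s : ℝ, s ≠ H y := by simp [ae_iff]
    filter_upwards [this] with s hs hs'
    exact ⟨lt_of_le_of_ne hs'.2 (Ne.symm hs), hs'.1.2⟩
  simp_rw [hpt]
  rw [integral_integral_swap, intervalIntegral.integral_of_le zero_le_one]
  · refine setIntegral_congr_fun measurableSet_Ioc fun s _ => ?_
    have : ∀ y, (Set.Ici (H y)).indicator (fun s => ((k : ℝ) + 1) * (1 - s) ^ k) s =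
        {y | H y ≤ s}.indicator (fun _ => ((k : ℝ) + 1) * (1 - s) ^ k) y := by
      intro y; simp [Set.indicator]
    simp_rw [this]
    rw [integral_indicator_const _ (measurableSet_le hH measurable_const), smul_eq_mul, mul_comm]
  · have hm : Measurable (Function.uncurry fun (y : Y) (s : ℝ) =>
        (Set.Ici (H y)).indicator (fun s => ((k : ℝ) + 1) * (1 - s) ^ k) s) := by
      have : (Function.uncurry fun (y : Y) (s : ℝ) =>
        (Set.Ici (H y)).indicator (fun s => ((k : ℝ) + 1) * (1 - s) ^ k) s) =
        {p : Y × ℝ | H p.1 ≤ p.2}.indicator (fun p => ((k : ℝ) + 1) * (1 - p.2) ^ k) := by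
        ext p; simp [Set.indicator, Function.uncurry]
      rw [this]
      exact Measurable.indicator (by fun_prop)
        (measurableSet_le (hH.comp measurable_fst) measurable_snd)
    refine Integrable.of_bound hm.aestronglyMeasurable ((k : ℝ) + 1) ?_
    have hae : ∀ᵐ p ∂(μ.prod (volume.restrict (Set.Ioc (0 : ℝ) 1))), p.2 ∈ Set.Ioc (0 : ℝ) 1 :=
      Measure.quasiMeasurePreserving_snd.ae (ae_restrict_mem measurableSet_Ioc)
    filter_upwards [hae] with p hp
    simp only [Function.uncurry]
    refine (norm_indicator_le_norm_self _ _).trans ?_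
    have hp0 : 0 ≤ 1 - p.2 := by linarith [hp.2]
    rw [Real.norm_of_nonneg (by positivity)]
    exact mul_le_of_le_one_right (by positivity) (pow_le_one₀ hp0 (by linarith [hp.1]))

/-- Against the weight `(k + 1) (1 - s) ^ k` of the layer-cake formula, scaled by `k + 2`, the
function `s ↦ s` has integral exactly `1` for every `k` (a Beta integral), whereas a constant
supported on `s > s₀` contributes a term that is exponentially small in `k`. -/
lemma integral_beta_weight (k : ℕ) (a c : ℝ) {s₀ : ℝ} (hs₀ : 0 ≤ s₀) (hs₁ : s₀ ≤ 1) :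
    IntervalIntegrable (fun s : ℝ => ((k : ℝ) + 1) * (1 - s) ^ k *
        (a * s + (Set.Ioi s₀).indicator (fun _ => c) s)) volume 0 1 ∧
    ((k : ℝ) + 2) * ∫ s in (0 : ℝ)..1, ((k : ℝ) + 1) * (1 - s) ^ k *
        (a * s + (Set.Ioi s₀).indicator (fun _ => c) s) =
      a + c * (((k : ℝ) + 2) * (1 - s₀) ^ (k + 1)) := by
  have e : (fun s : ℝ => ((k : ℝ) + 1) * (1 - s) ^ k *
        (a * s + (Set.Ioi s₀).indicator (fun _ => c) s)) = fun s =>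
        ((k : ℝ) + 1) * (1 - s) ^ k * (a * s) +
        (Set.Ioi s₀).indicator (fun s => ((k : ℝ) + 1) * (1 - s) ^ k * c) s := by
    ext s
    by_cases h : s ∈ Set.Ioi s₀ <;> simp [h, mul_add]
  have i1 : IntervalIntegrable (fun s : ℝ => ((k : ℝ) + 1) * (1 - s) ^ k * (a * s)) volume 0 1 :=
    Continuous.intervalIntegrable (by fun_prop) _ _
  have i2 : IntervalIntegrable ((Set.Ioi s₀).indicator
      (fun s : ℝ => ((k : ℝ) + 1) * (1 - s) ^ k * c)) volume 0 1 := by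
    rw [intervalIntegrable_iff]
    refine Integrable.indicator ?_ measurableSet_Ioi
    rw [← IntegrableOn, ← intervalIntegrable_iff]
    exact Continuous.intervalIntegrable (by fun_prop) _ _
  have hk1 : (k : ℝ) + 1 ≠ 0 := by positivity
  have hk2 : (k : ℝ) + 2 ≠ 0 := by positivity
  have hk2' : (k : ℝ) + 1 + 1 ≠ 0 := by positivity
  have v1 : ∫ s in (0 : ℝ)..1, ((k : ℝ) + 1) * (1 - s) ^ k * (a * s) = a / (k + 2) := by
    have : ∀ s : ℝ, ((k : ℝ) + 1) * (1 - s) ^ k * (a * s) =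
        (fun t : ℝ => (((k : ℝ) + 1) * a) * (t ^ k - t ^ (k + 1))) (1 - s) := by
      intro s; ring
    simp_rw [this]
    rw [intervalIntegral.integral_comp_sub_left
      (fun t : ℝ => (((k : ℝ) + 1) * a) * (t ^ k - t ^ (k + 1))) 1,
      intervalIntegral.integral_const_mul, intervalIntegral.integral_sub
      (Continuous.intervalIntegrable (by fun_prop) _ _)
      (Continuous.intervalIntegrable (by fun_prop) _ _), integral_pow, integral_pow]
    push_cast
    field_simp
    simp only [sub_self, sub_zero, one_pow, ne_eq, Nat.add_eq_zero_iff, one_ne_zero, and_false,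
      not_false_eq_true, zero_pow]
    ring
  have v2 : ∫ s in (0 : ℝ)..1, (Set.Ioi s₀).indicator
      (fun s : ℝ => ((k : ℝ) + 1) * (1 - s) ^ k * c) s = c * (1 - s₀) ^ (k + 1) := by
    rw [intervalIntegral.integral_of_le zero_le_one, setIntegral_indicator measurableSet_Ioi,
      show Set.Ioc (0 : ℝ) 1 ∩ Set.Ioi s₀ = Set.Ioc s₀ 1 by
        ext s; simp only [Set.mem_inter_iff, Set.mem_Ioc, Set.mem_Ioi]
        exact ⟨fun h => ⟨h.2, h.1.2⟩, fun h => ⟨⟨hs₀.trans_lt h.1, h.2⟩, h.1⟩⟩,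
      ← intervalIntegral.integral_of_le hs₁, intervalIntegral.integral_mul_const,
      intervalIntegral.integral_const_mul,
      intervalIntegral.integral_comp_sub_left (fun s : ℝ => s ^ k) 1, integral_pow]
    field_simp
    simp
  rw [e]
  refine ⟨i1.add i2, ?_⟩
  rw [intervalIntegral.integral_add i1 i2, v1, v2]
  field_simp

lemma intervalIntegrable_pow_mul_cdf {Y : Type*} [MeasurableSpace Y] (μ : Measure Y)
    [IsFiniteMeasure μ] (H : Y → ℝ) (k : ℕ) :
    IntervalIntegrable (fun s : ℝ => ((k : ℝ) + 1) * (1 - s) ^ k * μ.real {y | H y ≤ s})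
      volume 0 1 := by
  have hmono : Monotone fun s : ℝ => μ.real {y | H y ≤ s} := fun s t hst =>
    measureReal_mono fun y (hy : H y ≤ s) => hy.trans hst
  exact (hmono.intervalIntegrable).continuousOn_mul (by fun_prop)

lemma integral_one_sub_pow_le {Y : Type*} [MeasurableSpace Y] (μ : Measure Y)
    [IsProbabilityMeasure μ] {H : Y → ℝ} (hH : Measurable H) (h0 : ∀ y, 0 ≤ H y)
    (h1 : ∀ y, H y ≤ 1) {a c s₀ : ℝ} (hs₀ : 0 ≤ s₀) (hs₁ : s₀ ≤ 1)
    (hD : ∀ s ∈ Set.Ioo (0 : ℝ) 1,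
      μ.real {y | H y ≤ s} ≤ a * s + (Set.Ioi s₀).indicator (fun _ => c) s) (k : ℕ) :
    ((k : ℝ) + 2) * ∫ y, (1 - H y) ^ (k + 1) ∂μ ≤
      a + c * (((k : ℝ) + 2) * (1 - s₀) ^ (k + 1)) := by
  obtain ⟨hi, hv⟩ := integral_beta_weight k a c hs₀ hs₁
  rw [integral_one_sub_pow_eq_integral_cdf μ hH h0 h1, ← hv]
  gcongr
  refine intervalIntegral.integral_mono_on_of_le_Ioo zero_le_one
    (intervalIntegrable_pow_mul_cdf μ H k) hi fun s hs => ?_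
  have : 0 ≤ 1 - s := by linarith [hs.2]
  exact mul_le_mul_of_nonneg_left (hD s hs) (by positivity)

lemma le_integral_one_sub_pow {Y : Type*} [MeasurableSpace Y] (μ : Measure Y)
    [IsProbabilityMeasure μ] {H : Y → ℝ} (hH : Measurable H) (h0 : ∀ y, 0 ≤ H y)
    (h1 : ∀ y, H y ≤ 1) {a c s₀ : ℝ} (hs₀ : 0 ≤ s₀) (hs₁ : s₀ ≤ 1)
    (hD : ∀ s ∈ Set.Ioo (0 : ℝ) 1,
      a * s + (Set.Ioi s₀).indicator (fun _ => c) s ≤ μ.real {y | H y ≤ s}) (k : ℕ) :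
    a + c * (((k : ℝ) + 2) * (1 - s₀) ^ (k + 1)) ≤
      ((k : ℝ) + 2) * ∫ y, (1 - H y) ^ (k + 1) ∂μ := by
  obtain ⟨hi, hv⟩ := integral_beta_weight k a c hs₀ hs₁
  rw [integral_one_sub_pow_eq_integral_cdf μ hH h0 h1, ← hv]
  gcongr
  refine intervalIntegral.integral_mono_on_of_le_Ioo zero_le_one hi
    (intervalIntegrable_pow_mul_cdf μ H k) fun s hs => ?_
  have : 0 ≤ 1 - s := by linarith [hs.2]
  exact mul_le_mul_of_nonneg_left (hD s hs) (by positivity)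

/-- An Abelian theorem: the behaviour of the distribution function of `H` at `0` determines the
limit of the rescaled integrals of the powers of `1 - H`. -/
lemma tendsto_integral_one_sub_pow {Y : Type*} [MeasurableSpace Y] (μ : Measure Y)
    [IsProbabilityMeasure μ] {H : Y → ℝ} (hH : Measurable H) (h0 : ∀ y, 0 ≤ H y)
    (h1 : ∀ y, H y ≤ 1) {q : ℝ}
    (hq : Tendsto (fun s => μ.real {y | H y ≤ s} / s) (𝓝[>] 0) (𝓝 q)) :
    Tendsto (fun k : ℕ => ((k : ℝ) + 2) * ∫ y, (1 - H y) ^ (k + 1) ∂μ) atTop (𝓝 q) := by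
  -- the part of the weight beyond a fixed `s₀ > 0` is negligible
  have htail : ∀ s₀ : ℝ, 0 < s₀ → s₀ ≤ 1 → ∀ c : ℝ,
      Tendsto (fun k : ℕ => c * (((k : ℝ) + 2) * (1 - s₀) ^ (k + 1))) atTop (𝓝 0) := by
    intro s₀ hs₀ hs₁ c
    have hr0 : 0 ≤ 1 - s₀ := by linarith
    have hr1 : 1 - s₀ < 1 := by linarith
    have t1 := tendsto_self_mul_const_pow_of_lt_one hr0 hr1
    have t2 := tendsto_pow_atTop_nhds_zero_of_lt_one hr0 hr1
    have := (((t1.add (t2.const_mul 2)).mul_const (1 - s₀)).const_mul c)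
    simp only [mul_zero, add_zero, zero_mul] at this
    refine this.congr fun k => ?_
    ring
  have hD1 : ∀ s, μ.real {y | H y ≤ s} ≤ 1 := fun s => measureReal_le_one
  rw [tendsto_order] at hq ⊢
  constructor
  · intro b hb
    obtain ⟨a, hba, haq⟩ := exists_between hb
    obtain ⟨u, hu0, hu⟩ := mem_nhdsGT_iff_exists_Ioo_subset.1 (hq.1 a haq)
    have hu0 : 0 < u := hu0
    obtain ⟨s₀, hs₀, hs₀'⟩ : ∃ s₀, 0 < s₀ ∧ s₀ < min u 1 := exists_between (by positivity)
    have hs₁ : s₀ ≤ 1 := (hs₀'.trans_le (min_le_right _ _)).le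
    have key := le_integral_one_sub_pow μ hH h0 h1 (a := a) (c := -|a|) hs₀.le hs₁ (by
      intro s hs
      by_cases hss : s₀ < s
      · have : a * s ≤ |a| := (le_abs_self _).trans (by
          rw [abs_mul, abs_of_pos hs.1]; exact mul_le_of_le_one_right (abs_nonneg _) hs.2.le)
        simp only [Set.mem_Ioi, hss, Set.indicator_of_mem]
        linarith [measureReal_nonneg (μ := μ) (s := {y | H y ≤ s})]
      · have := hu ⟨hs.1, (not_lt.1 hss).trans_lt (hs₀'.trans_le (min_le_left _ _))⟩
        simp only [Set.mem_Ioi, hss, not_false_eq_true, Set.indicator_of_notMem, add_zero]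
        exact ((lt_div_iff₀ hs.1).1 this).le)
    have hlim : Tendsto (fun k : ℕ => a + -|a| * (((k : ℝ) + 2) * (1 - s₀) ^ (k + 1))) atTop
        (𝓝 a) := by simpa using (htail s₀ hs₀ hs₁ (-|a|)).const_add a
    filter_upwards [(tendsto_order.1 hlim).1 b hba] with k hk
    exact hk.trans_le (key k)
  · intro b hb
    obtain ⟨a, hqa, hab⟩ := exists_between hb
    obtain ⟨u, hu0, hu⟩ := mem_nhdsGT_iff_exists_Ioo_subset.1 (hq.2 a hqa)
    have hu0 : 0 < u := hu0
    obtain ⟨s₀, hs₀, hs₀'⟩ : ∃ s₀, 0 < s₀ ∧ s₀ < min u 1 := exists_between (by positivity)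
    have hs₁ : s₀ ≤ 1 := (hs₀'.trans_le (min_le_right _ _)).le
    have key := integral_one_sub_pow_le μ hH h0 h1 (a := a) (c := 1 + |a|) hs₀.le hs₁ (by
      intro s hs
      by_cases hss : s₀ < s
      · have : -(a * s) ≤ |a| := (neg_le_abs _).trans (by
          rw [abs_mul, abs_of_pos hs.1]; exact mul_le_of_le_one_right (abs_nonneg _) hs.2.le)
        simp only [Set.mem_Ioi, hss, Set.indicator_of_mem]
        linarith [hD1 s]
      · have := hu ⟨hs.1, (not_lt.1 hss).trans_lt (hs₀'.trans_le (min_le_left _ _))⟩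
        simp only [Set.mem_Ioi, hss, not_false_eq_true, Set.indicator_of_notMem, add_zero]
        exact ((div_lt_iff₀ hs.1).1 this).le)
    have hlim : Tendsto (fun k : ℕ => a + (1 + |a|) * (((k : ℝ) + 2) * (1 - s₀) ^ (k + 1))) atTop
        (𝓝 a) := by simpa using (htail s₀ hs₀ hs₁ (1 + |a|)).const_add a
    filter_upwards [(tendsto_order.1 hlim).2 b hab] with k hk
    exact (key k).trans_lt hk

/-! ### A uniform bound for the distribution function, by cones -/

/-- Two vectors whose directions are both within `1 / 2` of `c` lie in a narrow cone, and there the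
longer of the two is closer to the shorter one than to the apex. -/
lemma norm_sub_lt_of_dist_normalize_lt {E : Type*} [NormedAddCommGroup E] [NormedSpace ℝ E]
    {u v c : E} (hv : v ≠ 0) (huv : ‖v‖ ≤ ‖u‖) (huc : dist (‖u‖⁻¹ • u) c < 1 / 2)
    (hvc : dist (‖v‖⁻¹ • v) c < 1 / 2) : ‖v - u‖ < ‖u‖ := by
  have hv0 : 0 < ‖v‖ := norm_pos_iff.2 hv
  have hu0 : 0 < ‖u‖ := hv0.trans_le huv
  have hd : ‖‖v‖⁻¹ • v - ‖u‖⁻¹ • u‖ < 1 := by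
    rw [← dist_eq_norm]
    have := dist_triangle_right (‖v‖⁻¹ • v) (‖u‖⁻¹ • u) c
    linarith
  have e : v - u = ‖v‖ • (‖v‖⁻¹ • v - ‖u‖⁻¹ • u) - (‖u‖ - ‖v‖) • (‖u‖⁻¹ • u) := by
    rw [smul_sub, sub_smul, smul_smul, smul_smul, smul_smul, mul_inv_cancel₀ hv0.ne',
      mul_inv_cancel₀ hu0.ne']
    simp only [one_smul]
    abel
  have hu1 : ‖‖u‖⁻¹ • u‖ = 1 := by
    rw [norm_smul, norm_inv, norm_norm, inv_mul_cancel₀ hu0.ne']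
  calc ‖v - u‖ ≤ ‖‖v‖ • (‖v‖⁻¹ • v - ‖u‖⁻¹ • u)‖ + ‖(‖u‖ - ‖v‖) • (‖u‖⁻¹ • u)‖ := by
        rw [e]; exact norm_sub_le _ _
    _ = ‖v‖ * ‖‖v‖⁻¹ • v - ‖u‖⁻¹ • u‖ + (‖u‖ - ‖v‖) := by
        rw [norm_smul, norm_norm, norm_smul, hu1, Real.norm_of_nonneg (sub_nonneg.2 huv), mul_one]
    _ < ‖v‖ * 1 + (‖u‖ - ‖v‖) := by gcongr
    _ = ‖u‖ := by ring

/-- The sets `B ∩ {ρ ≤ ρ y}`, `y ∈ B`, form a chain whose union is `B`, so a bound for all their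
measures passes to `B`. -/
lemma measure_le_of_forall_measure_inter_le {Y : Type*} [MeasurableSpace Y] (μ : Measure Y)
    (ρ : Y → ℝ) (B : Set Y) {σ : ENNReal} (h : ∀ y ∈ B, μ (B ∩ {z | ρ z ≤ ρ y}) ≤ σ) :
    μ B ≤ σ := by
  rcases B.eq_empty_or_nonempty with rfl | hB
  · simp
  set S : Set EReal := (fun y => (ρ y : EReal)) '' B
  by_cases hL : sSup S ∈ S
  · obtain ⟨y, hy, hyL⟩ := hL
    refine (measure_mono fun z hz => ?_).trans (h y hy)
    have : (ρ z : EReal) ≤ ρ y := (le_sSup (Set.mem_image_of_mem _ hz)).trans_eq hyL.symm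
    exact ⟨hz, EReal.coe_le_coe_iff.1 this⟩
  -- the supremum of `ρ` over `B` is not attained: exhaust `B` along a sequence
  · obtain ⟨u, hum, -, hut, huS⟩ := (isLUB_sSup S).exists_seq_monotone_tendsto (hB.image _)
    have hcov : B ⊆ ⋃ n, B ∩ {z | (ρ z : EReal) ≤ u n} := by
      intro z hz
      have hzS : (ρ z : EReal) ∈ S := Set.mem_image_of_mem _ hz
      have hlt : (ρ z : EReal) < sSup S := lt_of_le_of_ne (le_sSup hzS) fun e => hL (e ▸ hzS)
      obtain ⟨n, hn⟩ := (hut.eventually_const_lt hlt).exists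
      exact Set.mem_iUnion.2 ⟨n, hz, hn.le⟩
    have hmono : Monotone fun n => B ∩ {z | (ρ z : EReal) ≤ u n} := fun n n' hn z hz =>
      ⟨hz.1, le_trans hz.2 (hum hn)⟩
    refine (measure_mono hcov).trans ?_
    rw [hmono.measure_iUnion]
    refine iSup_le fun n => ?_
    obtain ⟨y, hy, hyu⟩ := huS n
    refine (measure_mono fun z hz => ?_).trans (h y hy)
    have : (ρ z : EReal) ≤ ρ y := hz.2.trans_eq hyu.symm
    exact ⟨hz.1, EReal.coe_le_coe_iff.1 this⟩

/-- A bound, uniform in `x` and in `μ`, for the distribution function at `s` of the measure of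
`ball x |x - y| ∪ ball y |x - y|` as a function of `y`. The constant is the number of narrow cones
needed to cover the space: inside one cone with apex `x`, every point other than `x` that is no
further from `x` than `y` lies in the ball around `y`. -/
lemma exists_forall_measureReal_sublevel_le {E : Type*} [NormedAddCommGroup E] [NormedSpace ℝ E]
    [FiniteDimensional ℝ E] (M : Set E) [MeasurableSpace M] :
    ∃ K : ℝ, ∀ (μ : Measure M) [IsFiniteMeasure μ] (x : M), μ {x} = 0 → ∀ H : M → ℝ,
      (∀ y, μ.real (Metric.ball x (dist x y) ∪ Metric.ball y (dist x y)) ≤ H y) →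
      ∀ s, 0 ≤ s → μ.real {y | H y ≤ s} ≤ K * s := by
  obtain ⟨t, -, htf, ht⟩ := (isCompact_sphere (0 : E) 1).finite_cover_balls
    (show (0 : ℝ) < 1 / 2 by norm_num)
  refine ⟨htf.toFinset.card, fun μ _ x hx H hH s hs => ?_⟩
  -- the part of the sublevel set in the cone with apex `x` around the direction `c`
  let B : E → Set M := fun c => {y | H y ≤ s ∧ y ≠ x ∧
    dist (‖(y : E) - x‖⁻¹ • ((y : E) - x)) c < 1 / 2}
  have hB : ∀ c, μ (B c) ≤ ENNReal.ofReal s := by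
    intro c
    refine measure_le_of_forall_measure_inter_le μ (fun y => dist x y) _ fun y hy => ?_
    have : μ (Metric.ball x (dist x y) ∪ Metric.ball y (dist x y)) ≤ ENNReal.ofReal s := by
      rw [← ofReal_measureReal]
      exact ENNReal.ofReal_le_ofReal ((hH y).trans hy.1)
    refine le_trans (measure_mono fun z hz => Or.inr ?_) this
    obtain ⟨⟨-, hzx, hzc⟩, hzy⟩ := hz
    have hzy : dist x z ≤ dist x y := hzy
    rw [Subtype.dist_eq, Subtype.dist_eq, dist_comm, dist_comm (x : E), dist_eq_norm,
      dist_eq_norm] at hzy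
    have := norm_sub_lt_of_dist_normalize_lt
      (sub_ne_zero.2 fun e => hzx (Subtype.ext e)) hzy hy.2.2 hzc
    rwa [sub_sub_sub_cancel_right, ← dist_eq_norm, ← dist_eq_norm, dist_comm (y : E) x] at this
  have hcov : {y | H y ≤ s} ⊆ {x} ∪ ⋃ c ∈ htf.toFinset, B c := by
    intro y hy
    by_cases hyx : y = x
    · exact Or.inl hyx
    have hne : ‖(y : E) - x‖ ≠ 0 := norm_ne_zero_iff.2 (sub_ne_zero.2 fun e => hyx (Subtype.ext e))
    have hsph : ‖(y : E) - x‖⁻¹ • ((y : E) - x) ∈ Metric.sphere (0 : E) 1 := by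
      rw [mem_sphere_zero_iff_norm, norm_smul, norm_inv, norm_norm, inv_mul_cancel₀ hne]
    obtain ⟨c, hc, hyc⟩ := Set.mem_iUnion₂.1 (ht hsph)
    exact Or.inr (Set.mem_iUnion₂.2 ⟨c, htf.mem_toFinset.2 hc, hy, hyx, hyc⟩)
  have : μ {y | H y ≤ s} ≤ ENNReal.ofReal (htf.toFinset.card * s) := by
    calc μ {y | H y ≤ s} ≤ μ {x} + ∑ c ∈ htf.toFinset, μ (B c) :=
          (measure_mono hcov).trans ((measure_union_le _ _).trans
            (by gcongr; exact measure_biUnion_finset_le _ _))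
      _ ≤ 0 + ∑ c ∈ htf.toFinset, ENNReal.ofReal s := by
          rw [hx]; gcongr with c _; exact hB c
      _ = _ := by
          rw [zero_add, Finset.sum_const, nsmul_eq_mul, ENNReal.ofReal_mul (by positivity),
            ENNReal.ofReal_natCast]
  exact ENNReal.toReal_le_of_le_ofReal (by positivity) this

/-! ### Volumes of unions of two balls -/

section
variable {F : Type*} [NormedAddCommGroup F] [InnerProductSpace ℝ F] [FiniteDimensional ℝ F]
  [MeasurableSpace F] [BorelSpace F]

lemma volume_ball_inter_ball_eq_of_norm_eq {v w : F} (h : ‖v‖ = ‖w‖) (ρ : ℝ) :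
    volume (Metric.ball 0 ρ ∩ Metric.ball v ρ) =
      volume (Metric.ball 0 ρ ∩ Metric.ball w ρ) := by
  set R : F ≃ₗᵢ[ℝ] F := (ℝ ∙ (v - w))ᗮ.reflection
  have hR : R v = w := Submodule.reflection_sub h
  have hpre : R ⁻¹' (Metric.ball 0 ρ ∩ Metric.ball w ρ) = Metric.ball 0 ρ ∩ Metric.ball v ρ := by
    ext x
    rw [← hR, Set.mem_preimage, Set.mem_inter_iff, Set.mem_inter_iff, mem_ball_zero_iff,
      mem_ball_zero_iff, R.norm_map, Metric.mem_ball, Metric.mem_ball, R.dist_map]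
  rw [← hpre, R.measurePreserving.measure_preimage
    (Metric.isOpen_ball.inter Metric.isOpen_ball).measurableSet.nullMeasurableSet]

/-- The lens in which two balls of equal radius meet shrinks as their centres move apart. -/
lemma volume_ball_inter_ball_anti {v w : F} (h : ‖w‖ ≤ ‖v‖) (ρ : ℝ) :
    volume (Metric.ball 0 ρ ∩ Metric.ball v ρ) ≤
      volume (Metric.ball 0 ρ ∩ Metric.ball w ρ) := by
  by_cases hw : w = 0
  · subst hw
    exact measure_mono fun x hx => ⟨hx.1, hx.1⟩
  have hw0 : 0 < ‖w‖ := norm_pos_iff.2 hw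
  set l := ‖v‖ / ‖w‖
  have hl : 1 ≤ l := (one_le_div hw0).2 h
  have hl0 : 0 < l := by linarith
  have hn : ‖v‖ = ‖l • w‖ := by
    rw [norm_smul, Real.norm_of_nonneg (by positivity), div_mul_cancel₀ _ hw0.ne']
  rw [volume_ball_inter_ball_eq_of_norm_eq hn]
  -- translating by `-((l - 1) / 2) • w` makes the two lenses concentric
  rw [← measure_preimage_add_right volume (-(((l - 1) / 2) • w))
    (Metric.ball 0 ρ ∩ Metric.ball w ρ)]
  refine measure_mono fun x hx => ?_
  obtain ⟨hx0, hxv⟩ := hx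
  rw [mem_ball_zero_iff] at hx0
  rw [mem_ball_iff_norm] at hxv
  -- every point of the segment from `x` to `x - l • w` lies in the ball
  have hconv : ∀ t : ℝ, 0 ≤ t → t ≤ l → ‖x - t • w‖ < ρ := by
    intro t ht0 htl
    have e : x - t • w = (1 - t / l) • x + (t / l) • (x - l • w) := by
      rw [smul_sub, smul_smul, div_mul_cancel₀ _ hl0.ne', sub_smul, one_smul]
      abel
    have hmem := convex_ball (0 : F) ρ (mem_ball_zero_iff.2 hx0) (mem_ball_zero_iff.2 hxv)
      (sub_nonneg.2 ((div_le_one hl0).2 htl)) (div_nonneg ht0 hl0.le) (sub_add_cancel 1 (t / l))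
    rwa [← e, mem_ball_zero_iff] at hmem
  constructor
  · rw [mem_ball_zero_iff]
    beta_reduce
    rw [← sub_eq_add_neg]
    exact hconv _ (by linarith) (by linarith)
  · rw [mem_ball_iff_norm]
    beta_reduce
    have := hconv ((l - 1) / 2 + 1) (by linarith) (by linarith)
    rwa [add_smul, one_smul, ← sub_sub, sub_eq_add_neg x] at this

lemma measureReal_ball_union_ball (v w : F) (ρ : ℝ) :
    volume.real (Metric.ball v ρ ∪ Metric.ball w ρ) =
      2 * volume.real (Metric.ball (0 : F) ρ) -
        volume.real (Metric.ball 0 ρ ∩ Metric.ball (w - v) ρ) := by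
  have h := measureReal_union_add_inter (μ := volume) (s := Metric.ball v ρ)
    (measurableSet_ball (x := w) (ε := ρ)) measure_ball_lt_top.ne measure_ball_lt_top.ne
  have hc : ∀ z : F, volume.real (Metric.ball z ρ) = volume.real (Metric.ball (0 : F) ρ) :=
    fun z => by simp only [measureReal_def, Measure.addHaar_ball_center]
  have hi : volume.real (Metric.ball v ρ ∩ Metric.ball w ρ) =
      volume.real (Metric.ball 0 ρ ∩ Metric.ball (w - v) ρ) := by
    rw [measureReal_def, measureReal_def, ← measure_preimage_add_right volume v]
    congr 2
    ext x
    simp [dist_eq_norm, sub_sub_eq_add_sub]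
  rw [hc v, hc w, hi] at h
  linarith

lemma measureReal_ball_union_ball_mono {v w v' w' : F} (h : dist v w ≤ dist v' w') (ρ : ℝ) :
    volume.real (Metric.ball v ρ ∪ Metric.ball w ρ) ≤
      volume.real (Metric.ball v' ρ ∪ Metric.ball w' ρ) := by
  rw [measureReal_ball_union_ball, measureReal_ball_union_ball]
  have : volume.real (Metric.ball 0 ρ ∩ Metric.ball (w' - v') ρ) ≤
      volume.real (Metric.ball 0 ρ ∩ Metric.ball (w - v) ρ) := by
    refine ENNReal.toReal_mono
      ((measure_mono Set.inter_subset_left).trans_lt measure_ball_lt_top).ne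
      (volume_ball_inter_ball_anti ?_ ρ)
    rwa [← dist_eq_norm, ← dist_eq_norm, dist_comm w, dist_comm w']
  linarith

lemma measureReal_closedBall_union_closedBall (v w : F) {ρ : ℝ} (hρ : ρ ≠ 0) :
    volume.real (Metric.closedBall v ρ ∪ Metric.closedBall w ρ) =
      volume.real (Metric.ball v ρ ∪ Metric.ball w ρ) := by
  have h : ∀ z : F, Metric.closedBall z ρ =ᵐ[volume] Metric.ball z ρ := by
    intro z
    rw [← Metric.ball_union_sphere]
    exact union_ae_eq_left_of_ae_eq_empty (ae_eq_empty.2 (Measure.addHaar_sphere_of_ne_zero _ z hρ))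
  exact measureReal_congr ((h v).union (h w))

open scoped Pointwise in
lemma measureReal_ball_union_ball_smul (v w : F) {ρ : ℝ} (hρ : 0 < ρ) :
    volume.real (Metric.ball (ρ • v) ρ ∪ Metric.ball (ρ • w) ρ) =
      ρ ^ Module.finrank ℝ F * volume.real (Metric.ball v 1 ∪ Metric.ball w 1) := by
  have : Metric.ball (ρ • v) ρ ∪ Metric.ball (ρ • w) ρ =
      ρ • (Metric.ball v 1 ∪ Metric.ball w 1) := by
    rw [Set.smul_set_union, smul_ball hρ.ne', smul_ball hρ.ne', Real.norm_of_nonneg hρ.le, mul_one]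
  rw [this, measureReal_def, Measure.addHaar_smul, ENNReal.toReal_mul, abs_of_pos (by positivity),
    ENNReal.toReal_ofReal (by positivity), measureReal_def]

end

section
variable {m : ℕ}

lemma measureReal_ball_eq (v : EuclideanSpace ℝ (Fin m)) {ρ : ℝ} (hρ : 0 < ρ) :
    volume.real (Metric.ball v ρ) = unitBallVolume m * ρ ^ m := by
  rw [measureReal_def, Measure.addHaar_ball_of_pos _ _ hρ, ENNReal.toReal_mul,
    ENNReal.toReal_ofReal (by positivity), finrank_euclideanSpace_fin, mul_comm]
  rfl

lemma measureReal_closedBall_eq (v : EuclideanSpace ℝ (Fin m)) {ρ : ℝ} (hρ : 0 ≤ ρ) :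
    volume.real (Metric.closedBall v ρ) = unitBallVolume m * ρ ^ m := by
  rw [measureReal_def, Measure.addHaar_closedBall _ _ hρ, ENNReal.toReal_mul,
    ENNReal.toReal_ofReal (by positivity), finrank_euclideanSpace_fin, mul_comm]
  rfl

lemma norm_firstBasisVector (hm : 1 ≤ m) :
    ‖(WithLp.toLp 2 fun i : Fin m => if i.val = 0 then (1 : ℝ) else 0)‖ = 1 := by
  have : (WithLp.toLp 2 fun i : Fin m => if i.val = 0 then (1 : ℝ) else 0) =
      EuclideanSpace.single (⟨0, hm⟩ : Fin m) (1 : ℝ) := by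
    ext i
    simp [Fin.ext_iff]
  rw [this]; simp

/-- A scaled copy of the two balls in the definition of `twoBallsVolume`. -/
lemma twoBallsVolume_mul_pow (hm : 1 ≤ m) {ρ : ℝ} (hρ : 0 < ρ) :
    ∃ e : EuclideanSpace ℝ (Fin m), dist 0 e = ρ ∧
      volume.real (Metric.ball 0 ρ ∪ Metric.ball e ρ) = twoBallsVolume m * ρ ^ m := by
  refine ⟨ρ • (WithLp.toLp 2 fun i : Fin m => if i.val = 0 then (1 : ℝ) else 0), ?_, ?_⟩
  · rw [dist_zero_left, norm_smul, norm_firstBasisVector hm, mul_one, Real.norm_of_nonneg hρ.le]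
  · have := measureReal_ball_union_ball_smul (0 : EuclideanSpace ℝ (Fin m))
      (WithLp.toLp 2 fun i : Fin m => if i.val = 0 then (1 : ℝ) else 0) hρ
    rw [smul_zero, finrank_euclideanSpace_fin] at this
    rw [this, mul_comm]; rfl

lemma twoBallsVolume_mul_pow_le (hm : 1 ≤ m) {ρ : ℝ} (hρ : 0 < ρ)
    {v w : EuclideanSpace ℝ (Fin m)} (h : ρ ≤ dist v w) :
    twoBallsVolume m * ρ ^ m ≤ volume.real (Metric.ball v ρ ∪ Metric.ball w ρ) := by
  obtain ⟨e, he, hv⟩ := twoBallsVolume_mul_pow hm hρ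
  rw [← hv]
  exact measureReal_ball_union_ball_mono (he.trans_le h) ρ

lemma measureReal_closedBall_union_closedBall_le (hm : 1 ≤ m) {ρ : ℝ} (hρ : 0 < ρ)
    {v w : EuclideanSpace ℝ (Fin m)} (h : dist v w ≤ ρ) :
    volume.real (Metric.closedBall v ρ ∪ Metric.closedBall w ρ) ≤ twoBallsVolume m * ρ ^ m := by
  obtain ⟨e, he, hv⟩ := twoBallsVolume_mul_pow hm hρ
  rw [← hv, measureReal_closedBall_union_closedBall _ _ hρ.ne']
  exact measureReal_ball_union_ball_mono (h.trans_eq he.symm) ρ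

lemma unitBallVolume_pos (m : ℕ) : 0 < unitBallVolume m :=
  ENNReal.toReal_pos (Metric.measure_ball_pos _ _ one_pos).ne' measure_ball_lt_top.ne

lemma twoBallsVolume_pos (m : ℕ) : 0 < twoBallsVolume m := by
  refine (unitBallVolume_pos m).trans_le (measureReal_mono Set.subset_union_left ?_)
  exact (measure_union_lt_top measure_ball_lt_top measure_ball_lt_top).ne
end

/-! ### Density points and near-isometric charts -/

section density
variable {m : ℕ}

/-- The point `z` is a density point of `ν` with density `a`: on measurable sets `A` contained in a
small ball around `z` of radius `r`, the measure `ν` agrees with `a` times Lebesgue measure up to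
`o(r ^ m)`, uniformly in the shape of `A`. -/
def IsDensityPoint (ν : Measure (EuclideanSpace ℝ (Fin m))) (z : EuclideanSpace ℝ (Fin m))
    (a : ℝ) : Prop :=
  ∀ ε > 0, ∃ δ > 0, ∀ r ∈ Set.Ioo 0 δ, ∀ A, MeasurableSet A → A ⊆ Metric.closedBall z r →
    |ν.real A - a * volume.real A| ≤ ε * r ^ m

/-- The Lebesgue differentiation theorem, in the form that almost every point is a Lebesgue point
of the density with a positive value. -/
lemma ae_exists_isDensityPoint (ν : Measure (EuclideanSpace ℝ (Fin m))) [IsFiniteMeasure ν]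
    (hν : ν ≪ volume) : ∀ᵐ z ∂ν, ∃ a > 0, IsDensityPoint ν z a := by
  set g : EuclideanSpace ℝ (Fin m) → ℝ := fun z => (ν.rnDeriv volume z).toReal
  have hg : Integrable g volume := Measure.integrable_toReal_rnDeriv
  have hgA : ∀ A, MeasurableSet A → ν.real A = ∫ z in A, g z := fun A hA =>
    (Measure.setIntegral_toReal_rnDeriv hν A).symm
  filter_upwards [hν.ae_le ((Besicovitch.vitaliFamily volume).ae_tendsto_average_norm_sub
      hg.locallyIntegrable), hν.ae_le (ν.rnDeriv_lt_top volume), Measure.rnDeriv_pos hν]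
    with z hz hlt hpos
  refine ⟨g z, ENNReal.toReal_pos hpos.ne' hlt.ne, fun ε hε => ?_⟩
  have hV := unitBallVolume_pos m
  have ht := hz.comp (Besicovitch.tendsto_filterAt volume z)
  obtain ⟨δ, hδ0, hδ⟩ := mem_nhdsGT_iff_exists_Ioo_subset.1
    (ht.eventually_lt_const (show (0 : ℝ) < ε / unitBallVolume m by positivity))
  refine ⟨δ, hδ0, fun r hr A hA hAr => ?_⟩
  have havg : ⨍ y in Metric.closedBall z r, ‖g y - g z‖ < ε / unitBallVolume m := hδ hr
  have hcb : volume (Metric.closedBall z r) ≠ ⊤ := measure_closedBall_lt_top.ne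
  have hint : IntegrableOn (fun y => g y - g z) (Metric.closedBall z r) volume :=
    hg.integrableOn.sub (integrableOn_const hcb)
  have hAfin : volume A ≠ ⊤ := ((measure_mono hAr).trans_lt measure_closedBall_lt_top).ne
  calc |ν.real A - g z * volume.real A| = ‖∫ y in A, (g y - g z)‖ := by
        rw [integral_sub hg.integrableOn (integrableOn_const hAfin), setIntegral_const, hgA A hA,
          smul_eq_mul, mul_comm, Real.norm_eq_abs]
    _ ≤ ∫ y in A, ‖g y - g z‖ := norm_integral_le_integral_norm _
    _ ≤ ∫ y in Metric.closedBall z r, ‖g y - g z‖ :=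
        setIntegral_mono_set hint.norm (ae_of_all _ fun _ => norm_nonneg _) hAr.eventuallyLE
    _ = volume.real (Metric.closedBall z r) * ⨍ y in Metric.closedBall z r, ‖g y - g z‖ := by
        rw [← smul_eq_mul, measure_smul_setAverage _ hcb]
    _ ≤ unitBallVolume m * r ^ m * (ε / unitBallVolume m) := by
        rw [measureReal_closedBall_eq z hr.1.le]
        have := hr.1
        gcongr
    _ = ε * r ^ m := by field_simp

end density

section immersion

/-- An injective linear map out of `ℝ^m` induces on `ℝ^m` the Euclidean norm in suitable linear
coordinates. -/
lemma exists_continuousLinearEquiv_norm_eq {E : Type*} [NormedAddCommGroup E]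
    [InnerProductSpace ℝ E] {m : ℕ} (L : EuclideanSpace ℝ (Fin m) →L[ℝ] E)
    (hL : Function.Injective L) :
    ∃ T : EuclideanSpace ℝ (Fin m) ≃L[ℝ] EuclideanSpace ℝ (Fin m), ∀ v, ‖T v‖ = ‖L v‖ := by
  let e := LinearEquiv.ofInjective (L : EuclideanSpace ℝ (Fin m) →ₗ[ℝ] E) hL
  have hfin : Module.finrank ℝ (LinearMap.range (L : EuclideanSpace ℝ (Fin m) →ₗ[ℝ] E)) = m := by
    rw [← e.finrank_eq, finrank_euclideanSpace_fin]
  let b := ((stdOrthonormalBasis ℝ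
    (LinearMap.range (L : EuclideanSpace ℝ (Fin m) →ₗ[ℝ] E))).reindex (finCongr hfin)).repr
  refine ⟨(e.trans b.toLinearEquiv).toContinuousLinearEquiv, fun v => ?_⟩
  change ‖b (e v)‖ = ‖L v‖
  rw [b.norm_map]
  rfl

/-- Near `u`, a strictly differentiable map is an isometry up to a factor `1 ± ε` in the linear
coordinates `T` in which its derivative is an isometry. -/
lemma HasStrictFDerivAt.eventually_dist_near_isometry {E : Type*} [NormedAddCommGroup E]
    [InnerProductSpace ℝ E] {m : ℕ} {φ : EuclideanSpace ℝ (Fin m) → E}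
    {L : EuclideanSpace ℝ (Fin m) →L[ℝ] E} {u : EuclideanSpace ℝ (Fin m)}
    (hφ : HasStrictFDerivAt φ L u) {T : EuclideanSpace ℝ (Fin m) ≃L[ℝ] EuclideanSpace ℝ (Fin m)}
    (hT : ∀ v, ‖T v‖ = ‖L v‖) {ε : ℝ} (hε : 0 < ε) :
    ∀ᶠ p in 𝓝 (u, u), (1 - ε) * dist (T p.1) (T p.2) ≤ dist (φ p.1) (φ p.2) ∧
      dist (φ p.1) (φ p.2) ≤ (1 + ε) * dist (T p.1) (T p.2) := by
  set C : ℝ := ‖(T.symm : EuclideanSpace ℝ (Fin m) →L[ℝ] EuclideanSpace ℝ (Fin m))‖ + 1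
  have hC : 0 < C := by positivity
  have hTC : ∀ v, ‖v‖ ≤ C * ‖T v‖ := by
    intro v
    calc ‖v‖ = ‖(T.symm : EuclideanSpace ℝ (Fin m) →L[ℝ] EuclideanSpace ℝ (Fin m)) (T v)‖ := by
          simp
      _ ≤ _ := (ContinuousLinearMap.le_opNorm _ _).trans (by gcongr; simp [C])
  filter_upwards [hφ.isLittleO.bound (show 0 < ε / C by positivity)] with p hp
  have h1 : ‖φ p.1 - φ p.2 - L (p.1 - p.2)‖ ≤ ε * ‖T (p.1 - p.2)‖ := by
    refine hp.trans ((mul_le_mul_of_nonneg_left (hTC _) (by positivity)).trans_eq ?_)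
    field_simp
  have h2 := abs_le.1 ((abs_norm_sub_norm_le (φ p.1 - φ p.2) (L (p.1 - p.2))).trans h1)
  rw [← hT] at h2
  rw [dist_eq_norm, dist_eq_norm, ← map_sub]
  constructor <;> linarith [h2.1, h2.2]

variable {d m : ℕ} {M : Set (EuclideanSpace ℝ (Fin d))}
  [ChartedSpace (EuclideanSpace ℝ (Fin m)) M]

/-- On the whole chart domain that comes with an immersion, the inverse chart has an injective
strict derivative: composed with the chart of `ℝ^d` it becomes the linear map `v ↦ (v, 0)`. -/
lemma Manifold.IsImmersionAt.exists_injective_hasStrictFDerivAt {x : M}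
    (h : Manifold.IsImmersionAt (𝓡 m) (𝓡 d) ∞ (Subtype.val : M → EuclideanSpace ℝ (Fin d)) x)
    {u : EuclideanSpace ℝ (Fin m)} (hu : u ∈ h.domChart.target) :
    ∃ L : EuclideanSpace ℝ (Fin m) →L[ℝ] EuclideanSpace ℝ (Fin d), Function.Injective L ∧
      HasStrictFDerivAt (fun z => (h.domChart.symm z : EuclideanSpace ℝ (Fin d))) L u := by
  set φ : EuclideanSpace ℝ (Fin m) → EuclideanSpace ℝ (Fin d) :=
    fun z => (h.domChart.symm z : EuclideanSpace ℝ (Fin d))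
  have hφd : ContDiffOn ℝ ∞ φ h.domChart.target := by
    rw [← contMDiffOn_iff_contDiffOn]
    exact h.contMDiffOn.comp (contMDiffOn_symm_of_mem_maximalAtlas h.domChart_mem_maximalAtlas)
      h.domChart.mapsTo_symm
  have hstrict : HasStrictFDerivAt φ (fderiv ℝ φ u) u :=
    (hφd.contDiffAt (h.domChart.open_target.mem_nhds hu)).hasStrictFDerivAt (by simp)
  refine ⟨_, ?_, hstrict⟩
  have hcu : φ u ∈ h.codChart.source :=
    h.source_subset_preimage_source (h.domChart.map_target hu)
  have hcd : DifferentiableAt ℝ h.codChart (φ u) := by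
    have : ContDiffOn ℝ ∞ h.codChart h.codChart.source := by
      rw [← contMDiffOn_iff_contDiffOn]
      exact contMDiffOn_of_mem_maximalAtlas h.codChart_mem_maximalAtlas
    exact (this.contDiffAt (h.codChart.open_source.mem_nhds hcu)).differentiableAt (by simp)
  have hcomp := hcd.hasFDerivAt.comp u hstrict.hasFDerivAt
  set Λ : EuclideanSpace ℝ (Fin m) →L[ℝ] EuclideanSpace ℝ (Fin d) :=
    (h.equiv : (EuclideanSpace ℝ (Fin m) × h.complement) →L[ℝ] EuclideanSpace ℝ (Fin d)).comp
      (ContinuousLinearMap.inl ℝ _ _)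
  have heq : (h.codChart ∘ φ) =ᶠ[𝓝 u] Λ := by
    filter_upwards [h.domChart.open_target.mem_nhds hu] with z hz
    have hz' : z ∈ (h.domChart.extend (𝓡 m)).target := by simpa using hz
    simpa [Λ] using h.writtenInCharts hz'
  have huniq := (Λ.hasFDerivAt.congr_of_eventuallyEq heq).unique hcomp
  intro v w hvw
  have : Λ v = Λ w := by
    have hv := DFunLike.congr_fun huniq v
    have hw := DFunLike.congr_fun huniq w
    simp only [ContinuousLinearMap.comp_apply, hvw] at hv hw
    exact hv.trans hw.symm
  exact congrArg Prod.fst (h.equiv.injective this)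

lemma Manifold.IsImmersionAt.exists_near_isometry {x : M}
    (h : Manifold.IsImmersionAt (𝓡 m) (𝓡 d) ∞ (Subtype.val : M → EuclideanSpace ℝ (Fin d)) x)
    {y : M} (hy : y ∈ h.domChart.source) :
    ∃ T : EuclideanSpace ℝ (Fin m) ≃L[ℝ] EuclideanSpace ℝ (Fin m), ∀ ε > 0,
      ∀ᶠ p in 𝓝 (y, y),
        (1 - ε) * dist (T (h.domChart p.1)) (T (h.domChart p.2)) ≤ dist p.1 p.2 ∧
        dist p.1 p.2 ≤ (1 + ε) * dist (T (h.domChart p.1)) (T (h.domChart p.2)) := by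
  obtain ⟨L, hLi, hL⟩ := h.exists_injective_hasStrictFDerivAt (h.domChart.map_source hy)
  obtain ⟨T, hT⟩ := exists_continuousLinearEquiv_norm_eq L hLi
  refine ⟨T, fun ε hε => ?_⟩
  have hc : ContinuousAt h.domChart y := h.domChart.continuousAt hy
  have hcc : Tendsto (Prod.map h.domChart h.domChart) (𝓝 (y, y))
      (𝓝 (h.domChart y, h.domChart y)) := by
    rw [nhds_prod_eq, nhds_prod_eq]; exact hc.tendsto.prodMap hc.tendsto
  have hs := h.domChart.open_source.mem_nhds hy
  filter_upwards [hcc.eventually (hL.eventually_dist_near_isometry hT hε),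
    prod_mem_nhds hs hs] with p hp hps
  simpa only [Prod.map_fst, Prod.map_snd, h.domChart.left_inv hps.1, h.domChart.left_inv hps.2,
    ← Subtype.dist_eq] using hp

end immersion

/-! ### Asymptotics of the measure of two balls on the submanifold -/

section localAsymptotics
variable {m : ℕ} {M : Type*} [PseudoMetricSpace M] [MeasurableSpace M] {μ : Measure M}
  {ψ : OpenPartialHomeomorph M (EuclideanSpace ℝ (Fin m))} {x : M} {a : ℝ}
  {T : EuclideanSpace ℝ (Fin m) ≃L[ℝ] EuclideanSpace ℝ (Fin m)}

lemma measureReal_map_chart [BorelSpace M] (ψ : OpenPartialHomeomorph M (EuclideanSpace ℝ (Fin m)))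
    {A : Set (EuclideanSpace ℝ (Fin m))} (hA : MeasurableSet A) :
    ((μ.restrict ψ.source).map ψ).real A = μ.real (ψ ⁻¹' A ∩ ψ.source) := by
  have hm : AEMeasurable ψ (μ.restrict ψ.source) :=
    ψ.continuousOn.aemeasurable ψ.open_source.measurableSet
  rw [measureReal_def, Measure.map_apply_of_aemeasurable hm hA, measureReal_def,
    Measure.restrict_apply' ψ.open_source.measurableSet]

/-- At a density point in the chart `ψ`, the measure of a union of two small balls of `M` is
compared with `b` times the volume of a union of two balls in the coordinates `T ∘ ψ`. The constant
`b` is the density `a` times the Jacobian of `T⁻¹`. -/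
lemma IsDensityPoint.exists_forall_measureReal_bounds [BorelSpace M] [IsFiniteMeasure μ]
    (hx : x ∈ ψ.source) (ha : 0 < a)
    (hd : IsDensityPoint ((μ.restrict ψ.source).map ψ) (ψ x) a)
    (hT : ∀ ε > 0, ∀ᶠ p in 𝓝 (x, x),
        (1 - ε) * dist (T (ψ p.1)) (T (ψ p.2)) ≤ dist p.1 p.2 ∧
        dist p.1 p.2 ≤ (1 + ε) * dist (T (ψ p.1)) (T (ψ p.2))) :
    ∃ b > 0, ∀ ε ∈ Set.Ioo (0 : ℝ) 1, ∃ δ > 0, ∀ r ∈ Set.Ioo 0 δ, ∀ y, dist x y ≤ r →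
      ((1 - ε) * dist (T (ψ x)) (T (ψ y)) ≤ dist x y ∧
        dist x y ≤ (1 + ε) * dist (T (ψ x)) (T (ψ y))) ∧
      b * volume.real (Metric.ball (T (ψ x)) (r / (1 + ε)) ∪
        Metric.ball (T (ψ y)) (r / (1 + ε))) - ε * r ^ m ≤
        μ.real (Metric.ball x r ∪ Metric.ball y r) ∧
      μ.real (Metric.closedBall x r ∪ Metric.closedBall y r) ≤
        b * volume.real (Metric.closedBall (T (ψ x)) (r / (1 - ε)) ∪
          Metric.closedBall (T (ψ y)) (r / (1 - ε))) + ε * r ^ m := by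
  -- the Jacobian of the linear change of coordinates
  set J : ℝ := |LinearMap.det
    (T.symm : EuclideanSpace ℝ (Fin m) →ₗ[ℝ] EuclideanSpace ℝ (Fin m))|
  have hJ : 0 < J := by
    have := LinearEquiv.isUnit_det' T.symm.toLinearEquiv
    exact abs_pos.2 this.ne_zero
  have hvol : ∀ A, volume.real (T ⁻¹' A) = J * volume.real A := by
    intro A
    rw [measureReal_def, Measure.addHaar_preimage_continuousLinearEquiv, ENNReal.toReal_mul,
      ENNReal.toReal_ofReal (abs_nonneg _), measureReal_def]
  refine ⟨a * J, by positivity, fun ε hε => ?_⟩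
  obtain ⟨hε0, hε1⟩ := hε
  have hε1' : 0 < 1 - ε := by linarith
  set C₀ : ℝ := ‖(T.symm : EuclideanSpace ℝ (Fin m) →L[ℝ] EuclideanSpace ℝ (Fin m))‖ + 1
  have hC₀ : 0 < C₀ := by positivity
  have hTC : ∀ v w, dist v w ≤ C₀ * dist (T v) (T w) := by
    intro v w
    rw [dist_eq_norm, dist_eq_norm, ← map_sub]
    calc ‖v - w‖ = ‖(T.symm : EuclideanSpace ℝ (Fin m) →L[ℝ] EuclideanSpace ℝ (Fin m))
          (T (v - w))‖ := by simp
      _ ≤ _ := (ContinuousLinearMap.le_opNorm _ _).trans (by gcongr; simp [C₀])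
  set C : ℝ := C₀ * (2 / (1 - ε))
  have hC : 0 < C := by positivity
  -- `δ₁`: the chart is nearly isometric on `ball x δ₁`
  obtain ⟨δ₁, hδ₁, hiso⟩ : ∃ δ₁ > 0, ∀ p ∈ Metric.ball x δ₁, p ∈ ψ.source ∧
      ∀ p' ∈ Metric.ball x δ₁, (1 - ε) * dist (T (ψ p)) (T (ψ p')) ≤ dist p p' ∧
        dist p p' ≤ (1 + ε) * dist (T (ψ p)) (T (ψ p')) := by
    obtain ⟨s, hs, hs'⟩ := Metric.eventually_nhds_iff_ball.1 (hT ε hε0)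
    obtain ⟨t, ht, ht'⟩ := Metric.mem_nhds_iff.1 (ψ.open_source.mem_nhds hx)
    refine ⟨min s t, lt_min hs ht, fun p hp => ⟨ht' (Metric.ball_subset_ball (min_le_right _ _) hp),
      fun p' hp' => hs' (p, p') ?_⟩⟩
    rw [← ball_prod_same]
    exact ⟨Metric.ball_subset_ball (min_le_left _ _) hp,
      Metric.ball_subset_ball (min_le_left _ _) hp'⟩
  have hx1 : x ∈ Metric.ball x δ₁ := Metric.mem_ball_self hδ₁
  -- `δ₂`: the inverse chart maps `ball (ψ x) δ₂` into `ball x δ₁`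
  obtain ⟨δ₂, hδ₂, hinv⟩ : ∃ δ₂ > 0, ∀ p ∈ ψ.source, ψ p ∈ Metric.ball (ψ x) δ₂ →
      p ∈ Metric.ball x δ₁ := by
    have hc := ψ.symm.continuousAt (ψ.map_source hx)
    rw [ContinuousAt, ψ.left_inv hx] at hc
    obtain ⟨δ₂, hδ₂, h⟩ := Metric.eventually_nhds_iff_ball.1
      (hc.eventually (Metric.ball_mem_nhds x hδ₁))
    exact ⟨δ₂, hδ₂, fun p hp hp' => ψ.left_inv hp ▸ h _ hp'⟩
  obtain ⟨δ₃, hδ₃, hdens⟩ := hd (ε / C ^ m) (by positivity)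
  refine ⟨min (δ₁ / 2) (min (δ₂ / C) (δ₃ / C)), by positivity, fun r hr y hy => ?_⟩
  obtain ⟨hr0, hr⟩ := hr
  rw [lt_min_iff, lt_min_iff, lt_div_iff₀ hC, lt_div_iff₀ hC] at hr
  obtain ⟨hr1, hr2, hr3⟩ := hr
  have hy1 : y ∈ Metric.ball x δ₁ := by rw [Metric.mem_ball, dist_comm]; linarith
  have hxy := (hiso x hx1).2 y hy1
  have hTxy : dist (T (ψ x)) (T (ψ y)) ≤ r / (1 - ε) := by
    rw [le_div_iff₀ hε1', mul_comm]; exact hxy.1.trans hy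
  have hle : r / (1 + ε) ≤ r / (1 - ε) := by gcongr; linarith
  -- density estimate for sets that are small in the linearized chart
  have key : ∀ A, MeasurableSet A → A ⊆ Metric.closedBall (T (ψ x)) (2 * (r / (1 - ε))) →
      T ⁻¹' A ⊆ Metric.closedBall (ψ x) (r * C) ∧
      |μ.real (ψ ⁻¹' (T ⁻¹' A) ∩ ψ.source) - a * J * volume.real A| ≤ ε * r ^ m := by
    intro A hA hAs
    have hA' : MeasurableSet (T ⁻¹' A) := T.continuous.measurable hA
    have hsub : T ⁻¹' A ⊆ Metric.closedBall (ψ x) (r * C) := by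
      intro z hz
      have h1 : dist (T z) (T (ψ x)) ≤ 2 * (r / (1 - ε)) := hAs hz
      calc dist z (ψ x) ≤ C₀ * dist (T z) (T (ψ x)) := hTC _ _
        _ ≤ C₀ * (2 * (r / (1 - ε))) := by gcongr
        _ = r * C := by simp only [C]; ring
    refine ⟨hsub, ?_⟩
    have := hdens (r * C) ⟨by positivity, hr3⟩ _ hA' hsub
    rw [measureReal_map_chart ψ hA', hvol, ← mul_assoc, mul_pow r C] at this
    refine this.trans_eq ?_
    field_simp
  constructor
  · exact hxy
  constructor
  · obtain ⟨hsub, hA⟩ := key (Metric.ball (T (ψ x)) (r / (1 + ε)) ∪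
        Metric.ball (T (ψ y)) (r / (1 + ε))) (measurableSet_ball.union measurableSet_ball) (by
      rintro z (hz | hz)
      · have : dist z (T (ψ x)) < r / (1 + ε) := hz
        have h0 : 0 ≤ r / (1 - ε) := by positivity
        rw [Metric.mem_closedBall]; linarith
      · have : dist z (T (ψ y)) < r / (1 + ε) := hz
        have := dist_triangle_right z (T (ψ x)) (T (ψ y))
        rw [Metric.mem_closedBall]; linarith)
    have hincl : ψ ⁻¹' (T ⁻¹' (Metric.ball (T (ψ x)) (r / (1 + ε)) ∪
        Metric.ball (T (ψ y)) (r / (1 + ε)))) ∩ ψ.source ⊆ Metric.ball x r ∪ Metric.ball y r := by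
      rintro p ⟨hp, hps⟩
      have hp1 : p ∈ Metric.ball x δ₁ := hinv p hps
        (Metric.closedBall_subset_ball hr2 (hsub hp))
      have h1ε : 0 < 1 + ε := by linarith
      rcases hp with hp | hp
      · left
        have h := ((hiso p hp1).2 x hx1).2
        have hp : dist (T (ψ p)) (T (ψ x)) < r / (1 + ε) := hp
        rw [lt_div_iff₀ h1ε] at hp
        rw [Metric.mem_ball]; linarith
      · right
        have h := ((hiso p hp1).2 y hy1).2
        have hp : dist (T (ψ p)) (T (ψ y)) < r / (1 + ε) := hp
        rw [lt_div_iff₀ h1ε] at hp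
        rw [Metric.mem_ball]; linarith
    have := measureReal_mono (μ := μ) hincl
    linarith [(abs_le.1 hA).1]
  · obtain ⟨-, hA⟩ := key (Metric.closedBall (T (ψ x)) (r / (1 - ε)) ∪
        Metric.closedBall (T (ψ y)) (r / (1 - ε)))
        (measurableSet_closedBall.union measurableSet_closedBall) (by
      rintro z (hz | hz)
      · have : dist z (T (ψ x)) ≤ r / (1 - ε) := hz
        have h0 : 0 ≤ r / (1 - ε) := by positivity
        rw [Metric.mem_closedBall]; linarith
      · have : dist z (T (ψ y)) ≤ r / (1 - ε) := hz
        have := dist_triangle_right z (T (ψ x)) (T (ψ y))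
        rw [Metric.mem_closedBall]; linarith)
    have hincl : Metric.closedBall x r ∪ Metric.closedBall y r ⊆
        ψ ⁻¹' (T ⁻¹' (Metric.closedBall (T (ψ x)) (r / (1 - ε)) ∪
        Metric.closedBall (T (ψ y)) (r / (1 - ε)))) ∩ ψ.source := by
      intro p hp
      have hp1 : p ∈ Metric.ball x δ₁ := by
        rw [Metric.mem_ball]
        rcases hp with hp | hp
        · rw [Metric.mem_closedBall] at hp; linarith
        · rw [Metric.mem_closedBall] at hp
          have := dist_triangle_right p x y
          linarith
      refine ⟨?_, (hiso p hp1).1⟩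
      rcases hp with hp | hp
      · left
        have h := ((hiso p hp1).2 x hx1).1
        rw [Metric.mem_closedBall] at hp ⊢
        rw [le_div_iff₀ hε1']; linarith
      · right
        have h := ((hiso p hp1).2 y hy1).1
        rw [Metric.mem_closedBall] at hp ⊢
        rw [le_div_iff₀ hε1']; linarith
    have := measureReal_mono (μ := μ) hincl
    linarith [(abs_le.1 hA).2]

/-- The measure `μ` looks near `x` like `b` times Lebesgue measure on `ℝ^m`, as far as single balls
around `x` and unions of two balls around `x` and `y` of radius `dist x y` are concerned. The lower
bounds are for open balls and the upper bounds for closed balls, which covers both kinds. -/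
def HasTwoBallAsymptotics (m : ℕ) (μ : Measure M) (x : M) : Prop :=
  ∃ b > 0, ∀ η > 0, ∃ δ > 0,
    (∀ r ∈ Set.Ioo 0 δ, (b * unitBallVolume m - η) * r ^ m ≤ μ.real (Metric.ball x r) ∧
      μ.real (Metric.closedBall x r) ≤ (b * unitBallVolume m + η) * r ^ m) ∧
    ∀ y, dist x y ∈ Set.Ioo 0 δ →
      (b * twoBallsVolume m - η) * dist x y ^ m ≤
        μ.real (Metric.ball x (dist x y) ∪ Metric.ball y (dist x y)) ∧
      μ.real (Metric.closedBall x (dist x y) ∪ Metric.closedBall y (dist x y)) ≤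
        (b * twoBallsVolume m + η) * dist x y ^ m

lemma IsDensityPoint.hasTwoBallAsymptotics [BorelSpace M] [IsFiniteMeasure μ]
    (hm : 1 ≤ m) (hx : x ∈ ψ.source) (ha : 0 < a)
    (hd : IsDensityPoint ((μ.restrict ψ.source).map ψ) (ψ x) a)
    (hT : ∀ ε > 0, ∀ᶠ p in 𝓝 (x, x),
        (1 - ε) * dist (T (ψ p.1)) (T (ψ p.2)) ≤ dist p.1 p.2 ∧
        dist p.1 p.2 ≤ (1 + ε) * dist (T (ψ p.1)) (T (ψ p.2))) :
    HasTwoBallAsymptotics m μ x := by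
  obtain ⟨b, hb, h⟩ := hd.exists_forall_measureReal_bounds hx ha hT
  refine ⟨b, hb, fun η hη => ?_⟩
  -- choice of the distortion `ε` for which the relative errors are below `η`
  have hlow : ∀ c : ℝ, ∀ᶠ ε in 𝓝[>] (0 : ℝ), b * c - η < b * (c / (1 + ε) ^ m) - ε := by
    intro c
    have : ContinuousAt (fun ε : ℝ => b * (c / (1 + ε) ^ m) - ε) 0 := by
      refine ContinuousAt.sub (continuousAt_const.mul (continuousAt_const.div ?_ ?_))
        continuousAt_id
      · fun_prop
      · simp
    refine (this.tendsto.mono_left nhdsWithin_le_nhds).eventually_const_lt ?_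
    simpa using hη
  have hupp : ∀ c : ℝ, ∀ᶠ ε in 𝓝[>] (0 : ℝ), b * (c / (1 - ε) ^ m) + ε < b * c + η := by
    intro c
    have : ContinuousAt (fun ε : ℝ => b * (c / (1 - ε) ^ m) + ε) 0 := by
      refine ContinuousAt.add (continuousAt_const.mul (continuousAt_const.div ?_ ?_))
        continuousAt_id
      · fun_prop
      · simp
    refine (this.tendsto.mono_left nhdsWithin_le_nhds).eventually_lt_const ?_
    simpa using hη
  obtain ⟨ε, hl1, hu1, hl2, hu2, hε⟩ := ((hlow (unitBallVolume m)).and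
    ((hupp (unitBallVolume m)).and ((hlow (twoBallsVolume m)).and
    ((hupp (twoBallsVolume m)).and (Ioo_mem_nhdsGT (zero_lt_one' ℝ)))))).exists
  obtain ⟨δ, hδ, hδ'⟩ := h ε hε
  obtain ⟨hε0, hε1⟩ := hε
  have h1 : 0 < 1 + ε := by linarith
  have h2 : 0 < 1 - ε := by linarith
  refine ⟨δ, hδ, fun r hr => ?_, fun y hy => ?_⟩
  · obtain ⟨-, h3, h4⟩ := hδ' r hr x (by rw [dist_self]; exact hr.1.le)
    have hr0 := hr.1
    rw [Set.union_self, Set.union_self, measureReal_ball_eq _ (by positivity), div_pow] at h3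
    rw [Set.union_self, Set.union_self, measureReal_closedBall_eq _ (by positivity), div_pow] at h4
    constructor
    · refine le_trans ?_ h3
      refine (mul_le_mul_of_nonneg_right hl1.le (by positivity)).trans_eq ?_
      ring
    · refine h4.trans ?_
      refine Eq.trans_le ?_ (mul_le_mul_of_nonneg_right hu1.le (by positivity))
      ring
  · obtain ⟨⟨h5, h6⟩, h3, h4⟩ := hδ' (dist x y) hy y le_rfl
    set r := dist x y
    have hr0 : 0 < r := hy.1
    have h3' := twoBallsVolume_mul_pow_le hm (ρ := r / (1 + ε)) (by positivity)
      (v := T (ψ x)) (w := T (ψ y)) (by rw [div_le_iff₀ h1, mul_comm]; exact h6)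
    have h4' := measureReal_closedBall_union_closedBall_le hm (ρ := r / (1 - ε)) (by positivity)
      (v := T (ψ x)) (w := T (ψ y)) (by rw [le_div_iff₀ h2, mul_comm]; exact h5)
    rw [div_pow] at h3' h4'
    constructor
    · refine le_trans ?_ ((sub_le_sub_right (mul_le_mul_of_nonneg_left h3' hb.le) _).trans h3)
      refine (mul_le_mul_of_nonneg_right hl2.le (by positivity)).trans_eq ?_
      ring
    · refine (h4.trans (add_le_add_left (mul_le_mul_of_nonneg_left h4' hb.le) _)).trans ?_
      refine Eq.trans_le ?_ (mul_le_mul_of_nonneg_right hu2.le (by positivity))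
      ring

/-- As `H y` is of order `b U_m dist x y ^ m`, the set `{H ≤ s}` is close to a ball around `x`
of radius `(s / (b U_m)) ^ (1 / m)`, which has measure `(V_m / U_m) s` to first order. -/
lemma HasTwoBallAsymptotics.tendsto_measureReal_sublevel_div [IsFiniteMeasure μ] (hm : 1 ≤ m)
    (hx : HasTwoBallAsymptotics m μ x)
    (hx0 : μ (Metric.closedBall x 0) = 0) {H : M → ℝ}
    (hlow : ∀ y, μ.real (Metric.ball x (dist x y) ∪ Metric.ball y (dist x y)) ≤ H y)
    (hupp : ∀ y,
      H y ≤ μ.real (Metric.closedBall x (dist x y) ∪ Metric.closedBall y (dist x y))) :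
    Tendsto (fun s => μ.real {y | H y ≤ s} / s) (𝓝[>] 0) (𝓝 (nearestNeighborPairConst m)) := by
  obtain ⟨b, hb, h⟩ := hx
  set α := b * unitBallVolume m
  set β := b * twoBallsVolume m
  have hα : 0 < α := mul_pos hb (unitBallVolume_pos m)
  have hβ : 0 < β := mul_pos hb (twoBallsVolume_pos m)
  have hq : nearestNeighborPairConst m = α / β := by
    rw [mul_div_mul_left _ _ hb.ne']; rfl
  -- the radius `ρ` with `c * ρ ^ m = s` is small with `s`
  have hrad : ∀ c > 0, ∀ δ > 0, ∀ᶠ s in 𝓝[>] (0 : ℝ), ∃ ρ ∈ Set.Ioo 0 δ, c * ρ ^ m = s := by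
    intro c hc δ hδ
    filter_upwards [Ioo_mem_nhdsGT (show 0 < c * δ ^ m by positivity)] with s hs
    have hm0 : m ≠ 0 := by omega
    have hs0 : 0 < s / c := div_pos hs.1 hc
    have hp : ((s / c) ^ ((m : ℝ)⁻¹)) ^ m = s / c := Real.rpow_inv_natCast_pow hs0.le hm0
    refine ⟨(s / c) ^ ((m : ℝ)⁻¹), ⟨Real.rpow_pos_of_pos hs0 _, ?_⟩, ?_⟩
    · refine lt_of_pow_lt_pow_left₀ m hδ.le ?_
      rw [hp, div_lt_iff₀ hc, mul_comm]
      exact hs.2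
    · rw [hp]; field_simp
  rw [hq, tendsto_order]
  constructor
  · intro c hc
    have hcont : ContinuousAt (fun η : ℝ => (α - η) / (β + η)) 0 := by
      refine ContinuousAt.div (by fun_prop) (by fun_prop) (by simpa using hβ.ne')
    obtain ⟨η, hη, hη0⟩ := (((hcont.tendsto.mono_left nhdsWithin_le_nhds).eventually_const_lt
      (show c < (α - 0) / (β + 0) by simpa using hc)).and
      (self_mem_nhdsWithin (s := Set.Ioi 0))).exists
    have hη0 : 0 < η := hη0
    obtain ⟨δ, hδ, h1, h2⟩ := h η hη0
    have hβη : 0 < β + η := by positivity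
    filter_upwards [hrad (β + η) hβη δ hδ, self_mem_nhdsWithin] with s hs hs0
    have hs0 : 0 < s := hs0
    obtain ⟨ρ, hρ, hρs⟩ := hs
    have hsub : Metric.ball x ρ ⊆ {y | H y ≤ s} := by
      intro y hy
      rw [Metric.mem_ball, dist_comm] at hy
      rcases (dist_nonneg (x := x) (y := y)).eq_or_lt with hxy | hxy
      · refine (hupp y).trans ?_
        rw [← hxy]
        have : Metric.closedBall y 0 ⊆ Metric.closedBall x 0 := by
          intro z hz
          rw [Metric.mem_closedBall] at hz ⊢
          have := dist_triangle_right z x y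
          linarith
        rw [Set.union_eq_left.2 this, measureReal_def, hx0]
        exact hs0.le
      · calc H y ≤ _ := hupp y
          _ ≤ (β + η) * dist x y ^ m := (h2 y ⟨hxy, hy.trans hρ.2⟩).2
          _ ≤ (β + η) * ρ ^ m := by gcongr
          _ = s := hρs
    have hD := (h1 ρ hρ).1.trans (measureReal_mono hsub)
    refine hη.trans_le ?_
    rw [div_le_div_iff₀ hβη hs0]
    calc (α - η) * s = ((α - η) * ρ ^ m) * (β + η) := by rw [← hρs]; ring
      _ ≤ _ := by gcongr
  · intro c hc
    have hcont : ContinuousAt (fun η : ℝ => (α + η) / (β - η)) 0 := by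
      refine ContinuousAt.div (by fun_prop) (by fun_prop) (by simpa using hβ.ne')
    obtain ⟨η, hη, hη0, hηβ⟩ := (((hcont.tendsto.mono_left nhdsWithin_le_nhds).eventually_lt_const
      (show (α + 0) / (β - 0) < c by simpa using hc)).and (Ioo_mem_nhdsGT (lt_min hα hβ))).exists
    have hβη : 0 < β - η := sub_pos.2 (hηβ.trans_le (min_le_right _ _))
    have hαη : 0 < α - η := sub_pos.2 (hηβ.trans_le (min_le_left _ _))
    obtain ⟨δ, hδ, h1, h2⟩ := h η hη0
    -- below this level, `H y ≤ s` forces `y` to be close to `x`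
    have hs₁ : 0 < (α - η) * (δ / 2) ^ m := by positivity
    filter_upwards [hrad (β - η) hβη δ hδ, Ioo_mem_nhdsGT hs₁] with s hs hs0
    obtain ⟨ρ, hρ, hρs⟩ := hs
    have hsub : {y | H y ≤ s} ⊆ Metric.closedBall x ρ := by
      intro y hy
      have hy : H y ≤ s := hy
      rw [Metric.mem_closedBall, dist_comm]
      rcases (dist_nonneg (x := x) (y := y)).eq_or_lt with hxy | hxy
      · rw [← hxy]; exact hρ.1.le
      have hyδ : dist x y < δ := by
        by_contra hcon
        have h3 := (h1 (δ / 2) ⟨by positivity, by linarith⟩).1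
        have h4 : Metric.ball x (δ / 2) ⊆ Metric.ball x (dist x y) ∪ Metric.ball y (dist x y) :=
          (Metric.ball_subset_ball (by linarith)).trans Set.subset_union_left
        have h5 := (measureReal_mono (μ := μ) h4).trans (hlow y)
        linarith [hs0.2]
      have h6 := (h2 y ⟨hxy, hyδ⟩).1.trans ((hlow y).trans hy)
      rw [← hρs] at h6
      exact le_of_pow_le_pow_left₀ (by omega) hρ.1.le (le_of_mul_le_mul_left h6 hβη)
    have hD := (measureReal_mono hsub).trans (h1 ρ hρ).2
    refine lt_of_le_of_lt ?_ hη
    rw [div_le_div_iff₀ hs0.1 hβη]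
    calc μ.real {y | H y ≤ s} * (β - η) ≤ ((α + η) * ρ ^ m) * (β - η) := by gcongr
      _ = (α + η) * s := by rw [← hρs]; ring

end localAsymptotics

section submanifold
variable {d m : ℕ} {M : Set (EuclideanSpace ℝ (Fin d))}
  [ChartedSpace (EuclideanSpace ℝ (Fin m)) M] {μ : Measure M}

lemma AbsolutelyContinuousInCharts.measure_singleton [IsManifold (𝓡 m) ∞ M] (hm : 1 ≤ m)
    (hμ : AbsolutelyContinuousInCharts m μ) (x : M) : μ {x} = 0 := by
  have : Nonempty (Fin m) := ⟨⟨0, hm⟩⟩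
  set ψ := chartAt (EuclideanSpace ℝ (Fin m)) x
  have hac := hμ ψ (IsManifold.chart_mem_maximalAtlas x)
  have h0 := hac (MeasureTheory.measure_singleton (ψ x))
  have hm : AEMeasurable ψ (μ.restrict ψ.source) :=
    ψ.continuousOn.aemeasurable ψ.open_source.measurableSet
  rw [Measure.map_apply_of_aemeasurable hm (measurableSet_singleton _),
    Measure.restrict_apply' ψ.open_source.measurableSet] at h0
  refine measure_mono_null ?_ h0
  rintro _ rfl
  exact ⟨rfl, mem_chart_source _ _⟩

/-- Countably many of the charts provided by the immersion cover `M`, and in each of them almost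
every point is a density point. -/
lemma AbsolutelyContinuousInCharts.ae_hasTwoBallAsymptotics [IsFiniteMeasure μ] (hm : 1 ≤ m)
    (hM : Manifold.IsImmersion (𝓡 m) (𝓡 d) ∞ (Subtype.val : M → EuclideanSpace ℝ (Fin d)))
    (hμ : AbsolutelyContinuousInCharts m μ) : ∀ᵐ x ∂μ, HasTwoBallAsymptotics m μ x := by
  have himm := fun x => hM.isImmersionAt x
  obtain ⟨t, htc, ht⟩ := TopologicalSpace.countable_cover_nhds
    (fun x => (himm x).domChart.open_source.mem_nhds (himm x).mem_domChart_source)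
  have hx : ∀ x, ∀ᵐ y ∂μ, y ∈ (himm x).domChart.source → HasTwoBallAsymptotics m μ y := by
    intro x
    set ψ := (himm x).domChart
    have hψm : AEMeasurable ψ (μ.restrict ψ.source) :=
      ψ.continuousOn.aemeasurable ψ.open_source.measurableSet
    have hd := ae_of_ae_map hψm (ae_exists_isDensityPoint _
      (hμ ψ (himm x).domChart_mem_maximalAtlas))
    rw [ae_restrict_iff' ψ.open_source.measurableSet] at hd
    filter_upwards [hd] with y hy hys
    obtain ⟨a, ha, hya⟩ := hy hys
    obtain ⟨T, hT⟩ := (himm x).exists_near_isometry hys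
    exact hya.hasTwoBallAsymptotics hm hys ha hT
  filter_upwards [(ae_ball_iff htc).2 fun x _ => hx x] with y hy
  obtain ⟨x, hxt, hyx⟩ := Set.mem_iUnion₂.1 (ht ▸ Set.mem_univ y)
  exact hy x hxt hyx

end submanifold

/-! ### The expected number of mutual pairs -/

section sample
variable {M Ω : Type*} [MeasurableSpace M] [MeasurableSpace Ω] {μ : Measure M} {P : Measure Ω}
  [IsProbabilityMeasure P] {X : ℕ → Ω → M} {S : M → M → Set M}

lemma measurable_measureReal_section [IsProbabilityMeasure μ]
    (hS : MeasurableSet {p : (M × M) × M | p.2 ∈ S p.1.1 p.1.2}) :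
    Measurable fun p : M × M => μ.real (S p.1 p.2) :=
  (measurable_measure_prodMk_left hS).ennreal_toReal

lemma measurableSet_forall_notMem (hX : ∀ i, Measurable (X i))
    (hS : MeasurableSet {p : (M × M) × M | p.2 ∈ S p.1.1 p.1.2}) (i j : ℕ) (s : Finset ℕ) :
    MeasurableSet {w | ∀ k ∈ s, X k w ∉ S (X i w) (X j w)} := by
  have : {w | ∀ k ∈ s, X k w ∉ S (X i w) (X j w)} = ⋂ k ∈ s,
      ((fun w => ((X i w, X j w), X k w)) ⁻¹' {p : (M × M) × M | p.2 ∈ S p.1.1 p.1.2})ᶜ := by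
    ext w; simp
  rw [this]
  exact s.measurableSet_biInter fun k _ =>
    ((((hX i).prodMk (hX j)).prodMk (hX k)) hS).compl

/-- Given `X i = x` and `X j = y`, the points `X k`, `k ∈ s`, avoid `S x y` with probability
`(1 - μ (S x y)) ^ #s`. -/
lemma measureReal_forall_notMem_eq_integral (hX : ∀ i, Measurable (X i))
    (hlaw : ∀ i, P.map (X i) = μ) (hindep : iIndepFun X P)
    (hS : MeasurableSet {p : (M × M) × M | p.2 ∈ S p.1.1 p.1.2}) {i j : ℕ} (hij : i ≠ j)
    {s : Finset ℕ} (his : i ∉ s) (hjs : j ∉ s) :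
    P.real {w | ∀ k ∈ s, X k w ∉ S (X i w) (X j w)} =
      ∫ x, ∫ y, (1 - μ.real (S x y)) ^ s.card ∂μ ∂μ := by
  have hμ : IsProbabilityMeasure μ := hlaw 0 ▸ Measure.isProbabilityMeasure_map (hX 0).aemeasurable
  have hsec : ∀ p : M × M, MeasurableSet (S p.1 p.2) := fun p => measurable_prodMk_left hS
  -- the joint law of the pair `(X i, X j)` and the remaining points
  have hpair : P.map (fun w => (X i w, X j w)) = μ.prod μ := by
    rw [(indepFun_iff_map_prod_eq_prod_map_map (hX i).aemeasurable (hX j).aemeasurable).1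
      (hindep.indepFun hij), hlaw, hlaw]
  have hrest : P.map (fun w (k : s) => X k w) = Measure.pi fun _ : s => μ := by
    have h := (iIndepFun_iff_map_fun_eq_pi_map (fun k : s => (hX k).aemeasurable)).1
      (hindep.precomp Subtype.val_injective)
    simpa only [hlaw] using h
  have hmp : Measurable fun w => (X i w, X j w) := (hX i).prodMk (hX j)
  have hmr : Measurable fun w (k : s) => X k w := measurable_pi_lambda _ fun k => hX k
  have hind : IndepFun (fun w => (X i w, X j w)) (fun w (k : s) => X k w) P := by
    have hdis : Disjoint {i, j} s := by
      simp [Finset.disjoint_left, his, hjs]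
    have h := hindep.indepFun_finset {i, j} s hdis hX
    exact h.comp (φ := fun f : (({i, j} : Finset ℕ) → M) =>
      (f ⟨i, by simp⟩, f ⟨j, by simp⟩)) (ψ := id) (by fun_prop) measurable_id
  have hjoint : P.map (fun w => ((X i w, X j w), fun k : s => X k w)) =
      (μ.prod μ).prod (Measure.pi fun _ : s => μ) := by
    rw [(indepFun_iff_map_prod_eq_prod_map_map hmp.aemeasurable hmr.aemeasurable).1 hind,
      hpair, hrest]
  set A : Set ((M × M) × (s → M)) := {p | ∀ k, p.2 k ∉ S p.1.1 p.1.2}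
  have hA : MeasurableSet A := by
    have : A = ⋂ k, ((fun p : (M × M) × (s → M) => (p.1, p.2 k)) ⁻¹'
        {p : (M × M) × M | p.2 ∈ S p.1.1 p.1.2})ᶜ := by
      ext p; simp [A]
    rw [this]
    exact MeasurableSet.iInter fun k => ((by fun_prop : Measurable fun p : (M × M) × (s → M) =>
      (p.1, p.2 k)) hS).compl
  have hev : {w | ∀ k ∈ s, X k w ∉ S (X i w) (X j w)} =
      (fun w => ((X i w, X j w), fun k : s => X k w)) ⁻¹' A := by
    ext w; simp [A]
  have hsecA : ∀ p : M × M, (Measure.pi fun _ : s => μ) (Prod.mk p ⁻¹' A) =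
      μ (S p.1 p.2)ᶜ ^ s.card := by
    intro p
    have : Prod.mk p ⁻¹' A = Set.univ.pi fun _ => (S p.1 p.2)ᶜ := by
      ext f; simp [A]
    rw [this, Measure.pi_pi, Finset.prod_const, Finset.card_univ, Fintype.card_coe]
  have hmH := measurable_measureReal_section (μ := μ) hS
  rw [measureReal_def, hev, ← Measure.map_apply (hmp.prodMk hmr) hA, hjoint,
    Measure.prod_apply hA]
  simp_rw [hsecA]
  have hmc : Measurable fun p : M × M => μ (S p.1 p.2)ᶜ :=
    measurable_measure_prodMk_left hS.compl
  rw [← integral_toReal (hmc.pow_const _).aemeasurable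
    (ae_of_all _ fun p => ENNReal.pow_lt_top (measure_lt_top _ _))]
  have hcompl : ∀ p : M × M, (μ (S p.1 p.2)ᶜ ^ s.card).toReal =
      (1 - μ.real (S p.1 p.2)) ^ s.card := by
    intro p
    rw [ENNReal.toReal_pow, ← measureReal_def, probReal_compl_eq_one_sub (hsec p)]
  simp_rw [hcompl]
  refine integral_prod _ (Integrable.of_bound
    ((measurable_const.sub hmH).pow_const _).aestronglyMeasurable 1 (ae_of_all _ fun p => ?_))
  have h0 : 0 ≤ 1 - μ.real (S p.1 p.2) := sub_nonneg.2 measureReal_le_one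
  rw [Real.norm_of_nonneg (by positivity)]
  exact pow_le_one₀ h0 (by linarith [measureReal_nonneg (μ := μ) (s := S p.1 p.2)])

open Classical in
lemma mutualPairs_eq_sum {V : Type*} [Fintype V] (G : Digraph V) :
    (mutualPairs G : ℝ) = ∑ p ∈ (Finset.univ : Finset V).offDiag,
      if G.Adj p.1 p.2 ∧ G.Adj p.2 p.1 then (1 : ℝ) else 0 := by
  rw [Finset.sum_boole, mutualPairs]
  congr 1
  rw [← Set.ncard_coe_finset]
  congr 1
  ext p
  simp

/-- The expected number of mutual pairs in a graph for which being a mutual pair means that the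
region `S (X i) (X j)` contains no other sample point. The `n (n - 1)` ordered pairs contribute
equally. -/
lemma integral_mutualPairs_eq (hX : ∀ i, Measurable (X i))
    (hlaw : ∀ i, P.map (X i) = μ) (hindep : iIndepFun X P)
    (hS : MeasurableSet {p : (M × M) × M | p.2 ∈ S p.1.1 p.1.2}) {n : ℕ} (hn : 2 ≤ n)
    (G : Ω → Digraph (Fin n))
    (hG : ∀ w i j, i ≠ j → ((G w).Adj i j ∧ (G w).Adj j i ↔
      ∀ k : Fin n, k ≠ i → k ≠ j → X k w ∉ S (X i w) (X j w))) :
    ∫ w, (1 / (n : ℝ)) * (mutualPairs (G w) : ℝ) ∂P =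
      ((n : ℝ) - 1) * ∫ x, ∫ y, (1 - μ.real (S x y)) ^ (n - 2) ∂μ ∂μ := by
  classical
  let s : Fin n × Fin n → Finset ℕ := fun p => ((Finset.range n).erase p.1).erase p.2
  let A : Fin n × Fin n → Set Ω := fun p =>
    {w | ∀ k ∈ s p, X k w ∉ S (X p.1 w) (X p.2 w)}
  have hAm : ∀ p, MeasurableSet (A p) := fun p => measurableSet_forall_notMem hX hS _ _ _
  have hAP : ∀ p ∈ (Finset.univ : Finset (Fin n)).offDiag,
      P.real (A p) = ∫ x, ∫ y, (1 - μ.real (S x y)) ^ (n - 2) ∂μ ∂μ := by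
    intro p hp
    have hne : (p.1 : ℕ) ≠ p.2 := fun e => (Finset.mem_offDiag.1 hp).2.2 (Fin.ext e)
    have hcard : (s p).card = n - 2 := by
      rw [Finset.card_erase_of_mem (Finset.mem_erase.2 ⟨hne.symm, Finset.mem_range.2 p.2.2⟩),
        Finset.card_erase_of_mem (Finset.mem_range.2 p.1.2), Finset.card_range]
      omega
    rw [← hcard]
    exact measureReal_forall_notMem_eq_integral hX hlaw hindep hS hne (by simp [s]) (by simp [s])
  have hsum : ∀ w, (mutualPairs (G w) : ℝ) =
      ∑ p ∈ (Finset.univ : Finset (Fin n)).offDiag, (A p).indicator (fun _ => (1 : ℝ)) w := by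
    intro w
    rw [mutualPairs_eq_sum]
    refine Finset.sum_congr rfl fun p hp => ?_
    rw [Set.indicator_apply]
    refine if_congr ((hG w p.1 p.2 (Finset.mem_offDiag.1 hp).2.2).trans
      ⟨fun h k hk => ?_, fun h k hk1 hk2 => ?_⟩) rfl rfl
    · simp only [s, Finset.mem_erase, Finset.mem_range] at hk
      exact h ⟨k, hk.2.2⟩ (fun e => hk.2.1 (congrArg Fin.val e)) fun e => hk.1 (congrArg Fin.val e)
    · refine h k ?_
      simp only [s, Finset.mem_erase, Finset.mem_range]
      exact ⟨fun e => hk2 (Fin.ext e), fun e => hk1 (Fin.ext e), k.2⟩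
  simp_rw [hsum]
  rw [integral_const_mul, integral_finsetSum _ fun p _ =>
    (integrable_const (1 : ℝ)).indicator (hAm p)]
  have hint : ∀ p ∈ (Finset.univ : Finset (Fin n)).offDiag,
      ∫ w, (A p).indicator (fun _ => (1 : ℝ)) w ∂P =
        ∫ x, ∫ y, (1 - μ.real (S x y)) ^ (n - 2) ∂μ ∂μ := by
    intro p hp
    rw [integral_indicator_const _ (hAm p), smul_eq_mul, mul_one, hAP p hp]
  rw [Finset.sum_congr rfl hint, Finset.sum_const, Finset.offDiag_card, Finset.card_univ,
    Fintype.card_fin, nsmul_eq_mul, Nat.cast_sub (Nat.le_mul_self n)]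
  have hn0 : (n : ℝ) ≠ 0 := by positivity
  push_cast
  field_simp

end sample

section graphs
variable {E : Type*} [PseudoMetricSpace E] {n : ℕ} (x : Fin n → E) {i j : Fin n}

lemma nearestNeighborGraph_adj_and_adj_iff (hij : i ≠ j) :
    (nearestNeighborGraph x).Adj i j ∧ (nearestNeighborGraph x).Adj j i ↔
      ∀ k, k ≠ i → k ≠ j →
        x k ∉ Metric.ball (x i) (dist (x i) (x j)) ∪ Metric.ball (x j) (dist (x i) (x j)) := by
  simp only [nearestNeighborGraph, Set.mem_union, Metric.mem_ball, not_or, not_lt]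
  constructor
  · rintro ⟨⟨-, h1⟩, -, h2⟩ k hki hkj
    refine ⟨dist_comm (x i) (x k) ▸ h1 k hki, ?_⟩
    rw [dist_comm (x i), dist_comm (x k)]
    exact h2 k hkj
  · intro h
    refine ⟨⟨hij.symm, fun k hki => ?_⟩, hij, fun k hkj => ?_⟩
    · by_cases hkj : k = j
      · rw [hkj]
      · rw [dist_comm (x i) (x k)]
        exact (h k hki hkj).1
    · by_cases hki : k = i
      · rw [hki]
      · rw [dist_comm (x j) (x k), dist_comm (x j)]
        exact (h k hki hkj).2

lemma uniqueNearestNeighborGraph_adj_and_adj_iff (hij : i ≠ j) :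
    (uniqueNearestNeighborGraph x).Adj i j ∧ (uniqueNearestNeighborGraph x).Adj j i ↔
      ∀ k, k ≠ i → k ≠ j → x k ∉ Metric.closedBall (x i) (dist (x i) (x j)) ∪
        Metric.closedBall (x j) (dist (x i) (x j)) := by
  simp only [uniqueNearestNeighborGraph, Set.mem_union, Metric.mem_closedBall, not_or, not_le]
  constructor
  · rintro ⟨⟨-, h1⟩, -, h2⟩ k hki hkj
    refine ⟨dist_comm (x i) (x k) ▸ h1 k hki hkj, ?_⟩
    rw [dist_comm (x i), dist_comm (x k)]
    exact h2 k hkj hki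
  · intro h
    refine ⟨⟨hij.symm, fun k hki hkj => ?_⟩, hij, fun k hkj hki => ?_⟩
    · rw [dist_comm (x i) (x k)]
      exact (h k hki hkj).1
    · rw [dist_comm (x j) (x k), dist_comm (x j)]
      exact (h k hki hkj).2

end graphs

/-! ### The limit -/

section limit
variable {d m : ℕ} {M : Set (EuclideanSpace ℝ (Fin d))}
  [ChartedSpace (EuclideanSpace ℝ (Fin m)) M] [IsManifold (𝓡 m) ∞ M] {μ : Measure M}

/-- The limit for any region `S x y` between the unions of the open and of the closed balls: the
inner integrals converge almost everywhere and are bounded uniformly in `x`. -/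
lemma tendsto_mul_integral_one_sub_measureReal_pow [IsProbabilityMeasure μ] (hm : 1 ≤ m)
    (hM : Manifold.IsImmersion (𝓡 m) (𝓡 d) ∞ (Subtype.val : M → EuclideanSpace ℝ (Fin d)))
    (hμ : AbsolutelyContinuousInCharts m μ) {S : M → M → Set M}
    (hS : MeasurableSet {p : (M × M) × M | p.2 ∈ S p.1.1 p.1.2})
    (hlow : ∀ x y, Metric.ball x (dist x y) ∪ Metric.ball y (dist x y) ⊆ S x y)
    (hupp : ∀ x y, S x y ⊆ Metric.closedBall x (dist x y) ∪ Metric.closedBall y (dist x y)) :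
    Tendsto (fun k : ℕ => ((k : ℝ) + 2) * ∫ x, ∫ y, (1 - μ.real (S x y)) ^ (k + 1) ∂μ ∂μ)
      atTop (𝓝 (nearestNeighborPairConst m)) := by
  have hH := measurable_measureReal_section (μ := μ) hS
  have hHx : ∀ x, Measurable fun y => μ.real (S x y) := fun x => hH.comp measurable_prodMk_left
  have h0 : ∀ x y, 0 ≤ μ.real (S x y) := fun _ _ => measureReal_nonneg
  have h1 : ∀ x y, μ.real (S x y) ≤ 1 := fun _ _ => measureReal_le_one
  obtain ⟨K, hK⟩ := exists_forall_measureReal_sublevel_le M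
  have hbound : ∀ (k : ℕ) x, ((k : ℝ) + 2) * ∫ y, (1 - μ.real (S x y)) ^ (k + 1) ∂μ ≤ K := by
    intro k x
    have := integral_one_sub_pow_le μ (hHx x) (h0 x) (h1 x) (a := K) (c := 0) zero_le_one le_rfl
      (fun s hs => by
        simpa using hK μ x (hμ.measure_singleton hm x) _ (fun y => measureReal_mono (hlow x y))
          s hs.1.le) k
    simpa using this
  have hlim := tendsto_integral_of_dominated_convergence (μ := μ)
    (F := fun (k : ℕ) x => ((k : ℝ) + 2) * ∫ y, (1 - μ.real (S x y)) ^ (k + 1) ∂μ)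
    (f := fun _ => nearestNeighborPairConst m) (fun _ => K)
    (fun k => by
      have : StronglyMeasurable (Function.uncurry fun x y => (1 - μ.real (S x y)) ^ (k + 1)) :=
        ((measurable_const.sub hH).pow_const _).stronglyMeasurable
      exact (this.integral_prod_right.const_mul _).aestronglyMeasurable)
    (integrable_const _)
    (fun k => ae_of_all _ fun x => by
      rw [Real.norm_of_nonneg]
      · exact hbound k x
      · exact mul_nonneg (by positivity)
          (integral_nonneg fun y => pow_nonneg (sub_nonneg.2 (h1 x y)) _))
    (by
      filter_upwards [hμ.ae_hasTwoBallAsymptotics hm hM] with x hx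
      refine tendsto_integral_one_sub_pow μ (hHx x) (h0 x) (h1 x)
        (hx.tendsto_measureReal_sublevel_div hm ?_ (fun y => measureReal_mono (hlow x y))
          fun y => measureReal_mono (hupp x y))
      rw [Metric.closedBall_zero]
      exact hμ.measure_singleton hm x)
  simpa [integral_const_mul] using hlim

end limit

theorem lemmaq (d m : ℕ) (hm : 1 ≤ m)
    -- `M` is an `m`-dimensional embedded smooth submanifold of `ℝ^d`
    (M : Set (EuclideanSpace ℝ (Fin d)))
    [ChartedSpace (EuclideanSpace ℝ (Fin m)) M] [IsManifold (𝓡 m) ∞ M]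
    (hM : Manifold.IsSmoothEmbedding (𝓡 m) (𝓡 d) ∞ (Subtype.val : M → EuclideanSpace ℝ (Fin d)))
    -- the law on `M` of the sample points
    (μ : Measure M) (hμ : AbsolutelyContinuousInCharts m μ)
    -- an i.i.d. sample with this law
    {Ω : Type*} [MeasurableSpace Ω] (P : Measure Ω) [IsProbabilityMeasure P]
    (X : ℕ → Ω → M) (hX : ∀ i, Measurable (X i)) (hlaw : ∀ i, P.map (X i) = μ)
    (hindep : iIndepFun X P) :
    Tendsto (fun n : ℕ => ∫ w, (1 / (n : ℝ)) * (mutualPairs (nearestNeighborGraph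
        fun i : Fin n => (X i w : EuclideanSpace ℝ (Fin d))) : ℝ) ∂P)
      atTop (𝓝 (nearestNeighborPairConst m)) ∧
    Tendsto (fun n : ℕ => ∫ w, (1 / (n : ℝ)) * (mutualPairs (uniqueNearestNeighborGraph
        fun i : Fin n => (X i w : EuclideanSpace ℝ (Fin d))) : ℝ) ∂P)
      atTop (𝓝 (nearestNeighborPairConst m)) := by
  have hprob : IsProbabilityMeasure μ :=
    hlaw 0 ▸ Measure.isProbabilityMeasure_map (hX 0).aemeasurable
  have hlim : ∀ (S : M → M → Set M) (G : ∀ n, Ω → Digraph (Fin n)),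
      MeasurableSet {p : (M × M) × M | p.2 ∈ S p.1.1 p.1.2} →
      (∀ x y, Metric.ball x (dist x y) ∪ Metric.ball y (dist x y) ⊆ S x y) →
      (∀ x y, S x y ⊆ Metric.closedBall x (dist x y) ∪ Metric.closedBall y (dist x y)) →
      (∀ n w i j, i ≠ j → ((G n w).Adj i j ∧ (G n w).Adj j i ↔
        ∀ k : Fin n, k ≠ i → k ≠ j → X k w ∉ S (X i w) (X j w))) →
      Tendsto (fun n : ℕ => ∫ w, (1 / (n : ℝ)) * (mutualPairs (G n w) : ℝ) ∂P) atTop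
        (𝓝 (nearestNeighborPairConst m)) := by
    intro S G hS hlow hupp hG
    -- with `n = k + 3` points, `k + 1` of them are not in the pair
    rw [← tendsto_add_atTop_iff_nat 3]
    refine (tendsto_mul_integral_one_sub_measureReal_pow hm hM.isImmersion hμ hS hlow hupp).congr
      fun k => ?_
    rw [integral_mutualPairs_eq hX hlaw hindep hS (by omega) (G (k + 3)) (hG (k + 3))]
    congr 1
    push_cast
    ring
  have hsub : ∀ x y : M, Metric.ball x (dist x y) ∪ Metric.ball y (dist x y) ⊆
      Metric.closedBall x (dist x y) ∪ Metric.closedBall y (dist x y) := fun x y =>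
    Set.union_subset_union Metric.ball_subset_closedBall Metric.ball_subset_closedBall
  constructor
  · refine hlim (fun x y => Metric.ball x (dist x y) ∪ Metric.ball y (dist x y)) _ ?_
      (fun _ _ => subset_rfl) hsub
      fun n w i j hij => nearestNeighborGraph_adj_and_adj_iff _ hij
    exact (measurableSet_lt (by fun_prop) (by fun_prop)).union
      (measurableSet_lt (by fun_prop) (by fun_prop))
  · refine hlim (fun x y => Metric.closedBall x (dist x y) ∪ Metric.closedBall y (dist x y)) _ ?_
      hsub (fun _ _ => subset_rfl)
      fun n w i j hij => uniqueNearestNeighborGraph_adj_and_adj_iff _ hij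
    exact (measurableSet_le (by fun_prop) (by fun_prop)).union
      (measurableSet_le (by fun_prop) (by fun_prop))
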